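/- **Definitions.** For $\vec u=(u_1,u_2)\in\mathbb Z^2$ write $X^{\vec u}=x^{u_1}y^{u_2}$. A finite set $D\subseteq\mathbb Z^2$ is *convex* if $D=\mathrm{conv}(D)\cap\mathbb Z^2$, where $\mathrm{conv}(D)\subseteq\mathbb R^2$ is the real convex hull. For integers $a,b\ge 0$, a *$(D,b,a)$-covering* is a configuration $c\in\{0,1\}^{\mathbb Z^2}$ such that for every $\vec u\in\mathbb Z^2$ the set $\vec u+D$ contains exactly $b$ cells of colour $1$ if $c_{\vec u}=1$ and exactly $a$ cells of colour $1$ if $c_{\vec u}=0$. A configuration $c$ is *$\vec t$-periodic* if $c_{\vec u-\vec t}=c_{\vec u}$ for all $\vec u$; it is *periodic* if it is $\vec t$-periodic for some $\vec t\ne\vec 0$, and *two-periodic* if it is $\vec t$-periodic for two linearly independent vectors $\vec t$. Let $f_D=\sum_{\vec u\in D}X^{-\vec u}\in\mathbb C[x^{\pm1},y^{\pm1}]$. Let $g=\sum g_{\vec u}X^{\vec u}$ be a Laurent polynomial. A vector $\vec v=(v_1,v_2)\in\mathbb Z^2$ with coprime components is an *outer edge direction* of $g$ if, with $\vec v^\perp=(v_2,-v_1)$,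 there is $\vec t\in\mathbb Z^2$ such that $\langle\vec u-\vec t,\vec v^\perp\rangle\ge 0$ for every $\vec u$ in the support of $g$, with equality for at least two such $\vec u$. The *$\vec v$-fibers* of $g$ are the polynomials $\sum_{k\in\mathbb Z}g_{\vec u+k\vec v}X^{\vec u+k\vec v}$, $\vec u\in\mathbb Z^2$. A non-zero fiber can be written uniquely as $X^{\vec w}(a_0+a_1X^{\vec v}+\dots+a_nX^{n\vec v})$ with $a_0,a_n\ne 0$, and its *normal form* is $a_0+a_1t+\dots+a_nt^n\in\mathbb C[t]$; the normal form of the zero fiber is $0$. Let $\mathcal F_{\vec v}(g)$ be the set of normal forms of all non-zero $\vec v$-fibers, $\mathcal F'_{\vec v}(g)$ the set of normal forms of the non-zero $\vec v$-fibers with $\vec u\notin\mathbb Z\vec v$, and $g_{0,\vec v}$ the normal form of the $\vec v$-fiber through the origin. Put $\phi_n=1+t+\dots+t^{n-1}$ (so $\phi_0=0$ and $\phi_1=1$), and $\gcd(\emptyset)=0$. Two polynomials in $\mathbb C[t]$ have no common factors if all their common factors are units. **Theorem.** Let $D\subseteq\mathbb Z^2$ be a finite convex shape, let $a,b\ge0$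 be integers, let $g=f_D-(b-a)$, assume that $g\neq 0$, and let $E$ be the set of outer edge directions of $g$. 1. Assume that $b-a=0$. For $\vec v\in E$ let $d_{\vec v}=\gcd(n_1,\dots,n_r)$, where $\mathcal F_{\vec v}(g)=\{\phi_{n_1},\dots,\phi_{n_r}\}$. If $d_{\vec v}=1$ for all $\vec v\in E$, then every $(D,b,a)$-covering is two-periodic. If $d_{\vec v}=1$ for all but some (pairwise) parallel $\vec v\in E$, then every $(D,b,a)$-covering is periodic. 2. Assume that $b-a\ne0$. For $\vec v\in E$ let $d_{\vec v}=\gcd(n_1,\dots,n_r)$, where $\mathcal F'_{\vec v}(g)=\{\phi_{n_1},\dots,\phi_{n_r}\}$. If for every $\vec v\in E$ the polynomial $\phi_{d_{\vec v}}=1+t+\dots+t^{d_{\vec v}-1}$ and the polynomial $g_{0,\vec v}$ have no common factors, then every $(D,b,a)$-covering is two-periodic. If this condition holds for all but some (pairwise) parallel $\vec v\in E$, then every $(D,b,a)$-covering is periodic. The condition is satisfied by $\vec v$, in particular, if $d_{\vec v}=1$. -/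

import Mathlib

open Polynomial

namespace PerfectCovering

/-! ### Shapes and configurations on the grid -/

/-- The inclusion of the grid `ℤ²` in the plane `ℝ²`. -/
def toPlane (u : ℤ × ℤ) : ℝ × ℝ := ((u.1 : ℝ), (u.2 : ℝ))

/-- A finite shape `D ⊆ ℤ²` is convex if `D = conv(D) ∩ ℤ²`. -/
def IsConvexShape (D : Finset (ℤ × ℤ)) : Prop :=
  (D : Set (ℤ × ℤ)) = {u | toPlane u ∈ convexHull ℝ (toPlane '' (D : Set (ℤ × ℤ)))}

/-- `c` is `t`-periodic if its translate by `t` equals `c`. -/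
def IsPeriodicBy {A : Type*} (c : ℤ × ℤ → A) (t : ℤ × ℤ) : Prop :=
  ∀ u, c (u - t) = c u

/-- `c` is periodic if it has a non-zero vector of periodicity. -/
def IsPeriodic {A : Type*} (c : ℤ × ℤ → A) : Prop :=
  ∃ t : ℤ × ℤ, t ≠ 0 ∧ IsPeriodicBy c t

/-- `c` is two-periodic if it has two linearly independent vectors of periodicity. -/
def IsTwoPeriodic {A : Type*} (c : ℤ × ℤ → A) : Prop :=
  ∃ s t : ℤ × ℤ, LinearIndependent ℤ ![s, t] ∧ IsPeriodicBy c s ∧ IsPeriodicBy c t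

/-- `c ∈ {0,1}^{ℤ²}` is a `(D, b, a)`-covering: the neighbourhood `u + D` contains exactly `b` cells
of colour `1` if `u` has colour `1`, and exactly `a` of them if `u` has colour `0`. -/
def IsCovering (D : Finset (ℤ × ℤ)) (b a : ℕ) (c : ℤ × ℤ → Fin 2) : Prop :=
  ∀ u, (D.filter fun w => c (u + w) = 1).card = if c u = 1 then b else a

/-! ### Laurent polynomials in two variables -/

/-- The ring `ℂ[x^{±1}, y^{±1}]`; the monomial `a X^u` is `AddMonoidAlgebra.single u a`. -/
abbrev Laurent₂ : Type := AddMonoidAlgebra ℂ (ℤ × ℤ)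

/-- The characteristic polynomial `f_D = ∑_{u ∈ D} X^{-u}`. -/
noncomputable def charPoly (D : Finset (ℤ × ℤ)) : Laurent₂ :=
  ∑ u ∈ D, AddMonoidAlgebra.single (-u) 1

/-- The polynomial `g = f_D - (b - a)`. -/
noncomputable def coveringPoly (D : Finset (ℤ × ℤ)) (b a : ℕ) : Laurent₂ :=
  charPoly D - AddMonoidAlgebra.single 0 ((b : ℂ) - (a : ℂ))

/-! ### Directions and outer edges -/

/-- A vector of `ℤ²` is primitive if its components are relatively prime. -/
def IsPrimitive (v : ℤ × ℤ) : Prop := IsCoprime v.1 v.2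

/-- `w` is parallel to `v`, that is `w ∈ ℚ v` (used for non-zero vectors). -/
def Parallel (v w : ℤ × ℤ) : Prop :=
  ∃ q : ℚ, (w.1 : ℚ) = q * v.1 ∧ (w.2 : ℚ) = q * v.2

/-- The product `⟨u, v^⊥⟩`, where `v^⊥ = (v₂, -v₁)`. -/
def perpProd (v u : ℤ × ℤ) : ℤ := u.1 * v.2 - u.2 * v.1

/-- The finite set `S` has an outer edge in direction `v`: for some `t`, it is contained in the
translate by `t` of the closed half plane `⟨u, v^⊥⟩ ≥ 0` and contains at least two points of the
translate by `t` of the line `⟨u, v^⊥⟩ = 0`. -/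
def HasOuterEdge (S : Finset (ℤ × ℤ)) (v : ℤ × ℤ) : Prop :=
  ∃ t : ℤ × ℤ, (∀ u ∈ S, 0 ≤ perpProd v (u - t)) ∧
    2 ≤ (S.filter fun u => perpProd v (u - t) = 0).card

/-- The set of the (primitive) outer edge directions of a polynomial. -/
def outerEdgeDirections (f : Laurent₂) : Set (ℤ × ℤ) :=
  {v | IsPrimitive v ∧ HasOuterEdge f.coeff.support v}

/-! ### Fibers and their normal forms -/

open Classical in
/-- The `v`-fiber `∑_{k ∈ ℤ} f_{u + k v} X^{u + k v}` of `f` through `u`. -/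
noncomputable def fiber (v u : ℤ × ℤ) (f : Laurent₂) : Laurent₂ :=
  AddMonoidAlgebra.ofCoeff (f.coeff.filter fun w => ∃ k : ℤ, w = u + k • v)

/-- The polynomial `X^w (a₀ + a₁ X^v + ⋯ + aₙ X^{n v})` for `p = a₀ + a₁ t + ⋯ + aₙ tⁿ`. -/
noncomputable def linePoly (v w : ℤ × ℤ) (p : ℂ[X]) : Laurent₂ :=
  p.sum fun k a => AddMonoidAlgebra.single (w + k • v) a

/-- `p` is a normal form, in direction `v`, of `φ`: `a₀ ≠ 0` and `φ = X^w p(X^v)` for some `w`. -/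
def IsNormalForm (v : ℤ × ℤ) (φ : Laurent₂) (p : ℂ[X]) : Prop :=
  p.coeff 0 ≠ 0 ∧ ∃ w : ℤ × ℤ, φ = linePoly v w p

lemma linePoly_coeff {v : ℤ × ℤ} (hv : v ≠ 0) (w : ℤ × ℤ) (p : ℂ[X]) (k : ℕ) :
    (linePoly v w p).coeff (w + k • v) = p.coeff k := by
  have hinj : ∀ i : ℕ, w + i • v = w + k • v ↔ i = k := by
    intro i
    rw [add_right_inj, ← natCast_zsmul, ← natCast_zsmul, (smul_left_injective ℤ hv).eq_iff,
      Nat.cast_inj]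
  simp only [linePoly, Polynomial.sum, AddMonoidAlgebra.coeff_sum, AddMonoidAlgebra.coeff_single,
    Finsupp.finsetSum_apply, Finsupp.single_apply, hinj]
  simp only [Finset.sum_ite_eq', Polynomial.mem_support_iff]
  split_ifs with h
  · rfl
  · exact (not_not.mp h).symm

lemma exists_of_linePoly_coeff_ne_zero {v w z : ℤ × ℤ} {p : ℂ[X]}
    (h : (linePoly v w p).coeff z ≠ 0) : ∃ k : ℕ, z = w + k • v := by
  by_contra hz
  push Not at hz
  apply h
  simp only [linePoly, Polynomial.sum, AddMonoidAlgebra.coeff_sum, AddMonoidAlgebra.coeff_single,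
    Finsupp.finsetSum_apply, Finsupp.single_apply]
  exact Finset.sum_eq_zero fun i _ => if_neg fun e => hz i e.symm

/-- A normal form is unique. -/
theorem IsNormalForm.unique {v : ℤ × ℤ} (hv : v ≠ 0) {φ : Laurent₂} {p q : ℂ[X]}
    (hp : IsNormalForm v φ p) (hq : IsNormalForm v φ q) : p = q := by
  obtain ⟨hp0, w, hw⟩ := hp
  obtain ⟨hq0, z, hz⟩ := hq
  have h1 : ∃ k : ℕ, z = w + k • v := by
    apply exists_of_linePoly_coeff_ne_zero (p := p)
    have := linePoly_coeff hv z q 0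
    rw [zero_smul, add_zero, ← hz] at this
    rwa [← hw, this]
  have h2 : ∃ k : ℕ, w = z + k • v := by
    apply exists_of_linePoly_coeff_ne_zero (p := q)
    have := linePoly_coeff hv w p 0
    rw [zero_smul, add_zero, ← hw] at this
    rwa [← hz, this]
  obtain ⟨m, hm⟩ := h1
  obtain ⟨n, hn⟩ := h2
  have h3 : (n + m) • v = 0 := by
    have : w = w + (n + m) • v := by
      conv_lhs => rw [hn, hm]
      rw [add_smul]; abel
    simpa using this
  have h4 : n + m = 0 := by
    rcases smul_eq_zero.mp h3 with h | h
    · exact h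
    · exact absurd h hv
  have h5 : m = 0 := by omega
  subst h5
  rw [zero_smul, add_zero] at hm
  subst hm
  ext k
  rw [← linePoly_coeff hv z p k, ← linePoly_coeff hv z q k, ← hw, ← hz]

/-- Every non-zero `v`-fiber has a normal form. -/
theorem exists_isNormalForm_fiber {v : ℤ × ℤ} (hv : v ≠ 0) (u : ℤ × ℤ) (f : Laurent₂)
    (h : fiber v u f ≠ 0) : ∃ p, IsNormalForm v (fiber v u f) p := by
  classical
  have hinj : Function.Injective fun k : ℤ => u + k • v := fun i j hij =>
    smul_left_injective ℤ hv (add_left_cancel hij)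
  let S : Finset ℤ := (fiber v u f).coeff.support.preimage (fun k : ℤ => u + k • v) hinj.injOn
  have hmem : ∀ k, k ∈ S ↔ (fiber v u f).coeff (u + k • v) ≠ 0 := fun k => by
    simp [S]
  have hline : ∀ z, (fiber v u f).coeff z ≠ 0 → ∃ k : ℤ, z = u + k • v := by
    intro z hz
    by_contra hcon
    exact hz (Finsupp.filter_apply_neg _ _ hcon)
  have hne : S.Nonempty := by
    have : (fiber v u f).coeff.support.Nonempty := by
      rw [Finsupp.support_nonempty_iff]
      simpa using h
    obtain ⟨z, hz⟩ := this
    obtain ⟨k, rfl⟩ := hline z (Finsupp.mem_support_iff.mp hz)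
    exact ⟨k, (hmem k).mpr (Finsupp.mem_support_iff.mp hz)⟩
  let m : ℤ := S.min' hne
  have hm : m ∈ S := S.min'_mem hne
  have hle : ∀ k ∈ S, m ≤ k := fun k hk => S.min'_le k hk
  let a : ℤ → ℂ := fun k => (fiber v u f).coeff (u + k • v)
  refine ⟨∑ k ∈ S, Polynomial.monomial (k - m).toNat (a k), ?_, u + m • v, ?_⟩
  · rw [Polynomial.finsetSum_coeff, Finset.sum_eq_single m]
    · simpa [a] using (hmem m).mp hm
    · intro k hk hkm
      rw [Polynomial.coeff_monomial, if_neg]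
      have := hle k hk
      omega
    · exact fun h => absurd hm h
  · have hsum : linePoly v (u + m • v) (∑ k ∈ S, Polynomial.monomial (k - m).toNat (a k))
        = ∑ k ∈ S, AddMonoidAlgebra.single (u + k • v) (a k) := by
      have hadd : ∀ p q : ℂ[X], linePoly v (u + m • v) (p + q)
          = linePoly v (u + m • v) p + linePoly v (u + m • v) q := fun p q =>
        Polynomial.sum_add_index p q _ (fun _ => AddMonoidAlgebra.single_zero _)
          (fun _ _ _ => AddMonoidAlgebra.single_add _ _ _)
      let L : ℂ[X] →+ Laurent₂ := AddMonoidHom.mk' (linePoly v (u + m • v)) hadd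
      change L _ = _
      rw [map_sum]
      refine Finset.sum_congr rfl fun k hk => ?_
      change (Polynomial.monomial _ (a k)).sum _ = _
      rw [Polynomial.sum_monomial_index (a k) _ (by exact AddMonoidAlgebra.single_zero _)]
      congr 1
      rw [add_assoc, ← natCast_zsmul, ← add_smul, Int.toNat_of_nonneg (by have := hle k hk; omega)]
      congr 2
      ring
    rw [hsum]
    ext z
    simp only [AddMonoidAlgebra.coeff_sum, AddMonoidAlgebra.coeff_single, Finsupp.finsetSum_apply,
      Finsupp.single_apply]
    by_cases hz : (fiber v u f).coeff z = 0
    · rw [hz, Finset.sum_eq_zero]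
      intro k hk
      rw [if_neg]
      rintro rfl
      exact (hmem k).mp hk hz
    · obtain ⟨k, rfl⟩ := hline z hz
      rw [Finset.sum_eq_single k]
      · simp [a]
      · intro j _ hjk
        rw [if_neg fun e => hjk (hinj e)]
      · exact fun hk => absurd ((hmem k).mpr hz) hk

open Classical in
/-- The normal form of `φ` in direction `v`; the normal form of `0` is `0`. -/
noncomputable def normalForm (v : ℤ × ℤ) (φ : Laurent₂) : ℂ[X] :=
  if h : ∃ p, IsNormalForm v φ p then h.choose else 0

theorem normalForm_zero (v : ℤ × ℤ) (hv : v ≠ 0) : normalForm v 0 = 0 := by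
  rw [normalForm, dif_neg]
  rintro ⟨p, hp, w, hw⟩
  have := linePoly_coeff hv w p 0
  rw [← hw] at this
  exact hp (by simpa using this.symm)

theorem normalForm_eq {v : ℤ × ℤ} (hv : v ≠ 0) {φ : Laurent₂} {p : ℂ[X]}
    (hp : IsNormalForm v φ p) : normalForm v φ = p := by
  have h : ∃ p, IsNormalForm v φ p := ⟨p, hp⟩
  rw [normalForm, dif_pos h]
  exact h.choose_spec.unique hv hp

/-- The set `𝓕_v(f)` of the normal forms of all non-zero `v`-fibers of `f`. -/
def fiberForms (v : ℤ × ℤ) (f : Laurent₂) : Set ℂ[X] :=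
  {p | ∃ u : ℤ × ℤ, fiber v u f ≠ 0 ∧ p = normalForm v (fiber v u f)}

/-- The set `𝓕'_v(f)` of the normal forms of the non-zero `v`-fibers of `f` that do not pass through
the origin. -/
def fiberForms' (v : ℤ × ℤ) (f : Laurent₂) : Set ℂ[X] :=
  {p | ∃ u : ℤ × ℤ, (¬ ∃ k : ℤ, u = k • v) ∧ fiber v u f ≠ 0 ∧ p = normalForm v (fiber v u f)}

/-- The normal form of the `v`-fiber of `f` through the origin (it is `0` if that fiber is zero). -/
noncomputable def originForm (v : ℤ × ℤ) (f : Laurent₂) : ℂ[X] := normalForm v (fiber v 0 f)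

/-! ### The greatest common divisor of the fiber lengths -/

/-- The polynomial `φ_n = 1 + t + ⋯ + t^{n-1}`. -/
noncomputable def phi (n : ℕ) : ℂ[X] := ∑ i ∈ Finset.range n, X ^ i

/-- The greatest common divisor of a set of natural numbers. The supremum of an unbounded set of
natural numbers is `0` in Mathlib, so that `setGcd ∅ = 0`, as usual. -/
noncomputable def setGcd (S : Set ℕ) : ℕ := sSup {e | ∀ n ∈ S, e ∣ n}

theorem dvd_setGcd_iff (S : Set ℕ) (e : ℕ) : e ∣ setGcd S ↔ ∀ n ∈ S, e ∣ n := by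
  by_cases hS : ∃ n ∈ S, n ≠ 0
  · obtain ⟨n, hn, hn0⟩ := hS
    have hbdd : BddAbove {e | ∀ n ∈ S, e ∣ n} :=
      ⟨n, fun e he => Nat.le_of_dvd (Nat.pos_of_ne_zero hn0) (he n hn)⟩
    have hmem : setGcd S ∈ {e | ∀ n ∈ S, e ∣ n} :=
      Nat.sSup_mem ⟨1, fun n _ => one_dvd n⟩ hbdd
    refine ⟨fun h k hk => h.trans (hmem k hk), fun h => ?_⟩
    have hl : Nat.lcm e (setGcd S) ≤ setGcd S :=
      le_csSup hbdd fun k hk => Nat.lcm_dvd (h k hk) (hmem k hk)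
    have hpos : 0 < setGcd S := Nat.pos_of_dvd_of_pos (hmem n hn) (Nat.pos_of_ne_zero hn0)
    have : Nat.lcm e (setGcd S) = setGcd S :=
      le_antisymm hl (Nat.le_of_dvd
        (Nat.lcm_pos (Nat.pos_of_dvd_of_pos (h n hn) (Nat.pos_of_ne_zero hn0)) hpos)
        (Nat.dvd_lcm_right _ _))
    exact this ▸ Nat.dvd_lcm_left _ _
  · push Not at hS
    have huniv : {e | ∀ n ∈ S, e ∣ n} = Set.univ :=
      Set.eq_univ_of_forall fun e n hn => hS n hn ▸ dvd_zero e
    have : setGcd S = 0 := by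
      rw [setGcd, huniv]
      exact Nat.sSup_of_not_bddAbove fun ⟨M, hM⟩ => absurd (hM (Set.mem_univ (M + 1))) (by simp)
    simp only [this, dvd_zero, true_iff]
    exact fun n hn => hS n hn ▸ dvd_zero e

/-- `gcd(n₁, …, n_r)` where `φ_{n₁}, …, φ_{n_r}` are the members of `F` of the form `φ_n`, `n ≥ 1`. -/
noncomputable def lengthGcd (F : Set ℂ[X]) : ℕ := setGcd {n | 1 ≤ n ∧ phi n ∈ F}

/-- The condition on a direction `v` for `b ≠ a`: `φ_d` and the normal form of the fiber through the
origin have no common factors (all their common factors are units), where `d` is the greatest common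
divisor of the lengths of the other `v`-fibers. -/
def OriginCondition (v : ℤ × ℤ) (g : Laurent₂) : Prop :=
  IsRelPrime (phi (lengthGcd (fiberForms' v g))) (originForm v g)

end PerfectCovering

/-! Read as an operator in which `X^u` translates by `u`, the polynomial `g` sends a covering to the
constant configuration `a`. What matters is whether `g` has a line polynomial factor in a direction
`v`, that is, whether some substitution `X^v = z` with `z ≠ 0` kills all `v`-fibers (`NonVanishing`
denies this).

The hypotheses on fibers exclude such factors. A bad `z` would be a common root of the normal forms,
so a root of `φ_n` for every listed `n`, hence of `φ_d` (`eval_phi_lengthGcd`). This contradicts `d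
= 1`, or coprimality with the origin fiber.

Without line factors, a finite-valued `d` with `f d = 0` that vanishes on an open half plane
vanishes at the origin, which lies on the boundary. If the boundary direction is not an edge, an
extreme coefficient of `f` is isolated. If it is an edge, the successive lines form a power series
with sequences as coefficients, and Fourier analysis along the lines forces the first to vanish
(`eq_zero_of_convolution_eq_zero`). Compactness makes the determining sets finite and uniform over
all directions, so a large disc determines everything. Only finitely many configurations satisfy the
equation, translations permute them, and each is two-periodic.

If all line factors are parallel to `v`, write `f = φ h` up to a monomial, with `φ` their product.
Then `φ c` is two-periodic by the first case, and multiplying `φ` by `X^{Mv} - 1` gives a line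
polynomial that kills `c`, so `c` is periodic along `v`. -/

namespace PerfectCovering

/-! ### Sequences over a finite alphabet with a linear recurrence -/

/-- The right shift of two-sided sequences. -/
def seqShift : Module.End ℂ (ℤ → ℂ) := LinearMap.funLeft ℂ ℂ fun k => k - 1

@[simp] lemma seqShift_apply (f : ℤ → ℂ) (k : ℤ) : seqShift f k = f (k - 1) := rfl

lemma seqShift_pow_apply (n : ℕ) (f : ℤ → ℂ) (k : ℤ) : (seqShift ^ n) f k = f (k - n) := by
  induction n generalizing k with
  | zero => simp
  | succ n ih => rw [pow_succ', Module.End.mul_apply, seqShift_apply, ih]; push_cast; ring_nf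

lemma aeval_seqShift_apply (q : ℂ[X]) (f : ℤ → ℂ) (k : ℤ) :
    aeval seqShift q f k = q.sum fun i a => a * f (k - i) := by
  rw [aeval_eq_sum_range, Polynomial.sum_over_range _ (by simp)]
  simp [LinearMap.sum_apply, Finset.sum_apply, seqShift_pow_apply]

/-- The two extreme coefficients of `q` are non-zero, so the recurrence can be solved both ways: the
lowest one propagates zeros to the right, the highest one to the left. -/
lemma eq_zero_of_window {q : ℂ[X]} (hq : q ≠ 0) {f : ℤ → ℂ} (hf : aeval seqShift q f = 0)
    (h0 : ∀ i : ℕ, i < q.natDegree → f i = 0) : f = 0 := by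
  have hrec : ∀ k : ℤ, (q.sum fun i a => a * f (k - i)) = 0 := fun k => by
    rw [← aeval_seqShift_apply, hf]; rfl
  have hpos : ∀ m : ℕ, ∀ k : ℤ, 0 ≤ k → k < q.natDegree + m → f k = 0 := by
    intro m
    induction m with
    | zero => intro k h1 h2; lift k to ℕ using h1; exact h0 k (by simpa using h2)
    | succ m ih =>
      intro k h1 h2
      by_cases hk : k < q.natDegree + m
      · exact ih k h1 hk
      have hk' : k = q.natDegree + m := by push_cast at h2; omega
      -- At this position the lowest term of `q` reads `f k`; all others read indices in `[0, k)`.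
      have := hrec (k + q.natTrailingDegree)
      rw [Polynomial.sum, Finset.sum_eq_single q.natTrailingDegree] at this
      · have h3 := mul_eq_zero.mp this
        rcases h3 with h3 | h3
        · exact absurd h3 (by simpa using hq)
        · simpa using h3
      · intro i hi hne
        have hi1 := natTrailingDegree_le_of_mem_supp i hi
        have hi2 := le_natDegree_of_mem_supp i hi
        rw [ih _ (by omega) (by omega), mul_zero]
      · intro h; exact absurd (natTrailingDegree_mem_support_of_nonzero hq) h
  have hneg : ∀ m : ℕ, ∀ k : ℤ, -m ≤ k → f k = 0 := by
    intro m
    induction m with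
    | zero => intro k hk; exact hpos (k.toNat + 1) k (by simpa using hk) (by push_cast; omega)
    | succ m ih =>
      intro k hk
      by_cases hk2 : -(m : ℤ) ≤ k
      · exact ih k hk2
      have := hrec (k + q.natDegree)
      rw [Polynomial.sum, Finset.sum_eq_single q.natDegree] at this
      · have h3 := mul_eq_zero.mp this
        rcases h3 with h3 | h3
        · exact absurd h3 (by simpa using hq)
        · simpa using h3
      · intro i hi hne
        have hi2 := le_natDegree_of_mem_supp i hi
        rw [ih _ (by push_cast at hk; omega), mul_zero]
      · intro h; exact absurd (natDegree_mem_support_of_nonzero hq) h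
  ext k
  exact hneg k.natAbs k (by omega)

/-- An injective self-map that preserves a finite set has a power that fixes the set pointwise. -/
lemma exists_pow_fixes {α : Type*} {Y : Set α} (hY : Y.Finite) {s : α → α}
    (hs : Function.Injective s) (hm : ∀ y ∈ Y, s y ∈ Y) :
    ∃ N : ℕ, 0 < N ∧ ∀ y ∈ Y, s^[N] y = y := by
  have : Finite Y := hY
  let g : Y → Y := fun y => ⟨s y, hm y y.2⟩
  have hg : Function.Injective g := fun x y h => Subtype.ext (hs (congrArg Subtype.val h))
  let e : Equiv.Perm Y := Equiv.ofBijective g (Finite.injective_iff_bijective.mp hg)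
  refine ⟨orderOf e, orderOf_pos e, fun y hy => ?_⟩
  have h1 : ∀ n : ℕ, ∀ y : Y, ((e ^ n) y : α) = s^[n] y := by
    intro n
    induction n with
    | zero => intro y; rfl
    | succ n ih => intro y; rw [pow_succ, Equiv.Perm.mul_apply, ih, Function.iterate_succ_apply]; rfl
  have := h1 (orderOf e) ⟨y, hy⟩
  rw [pow_orderOf_eq_one] at this
  exact this.symm

/-- Sequences over a fixed finite alphabet that satisfy a fixed non-trivial linear recurrence have a
common period. -/
lemma exists_period_of_aeval_eq_zero {q : ℂ[X]} (hq : q ≠ 0) {A : Set ℂ} (hA : A.Finite) :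
    ∃ N : ℕ, 0 < N ∧ ∀ f : ℤ → ℂ, (∀ k, f k ∈ A) → aeval seqShift q f = 0 →
      (seqShift ^ N) f = f := by
  let Y : Set (ℤ → ℂ) := {f | (∀ k, f k ∈ A) ∧ aeval seqShift q f = 0}
  -- A solution is determined by a window of `q.natDegree` values in `A`.
  have hY : Y.Finite := by
    let W : (ℤ → ℂ) → (Fin q.natDegree → ℂ) := fun f i => f (i : ℕ)
    have hfin : (Set.pi Set.univ fun _ : Fin q.natDegree => A).Finite :=
      Set.Finite.pi fun _ => hA
    refine Set.Finite.of_finite_image (f := W) (hfin.subset ?_) ?_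
    · rintro _ ⟨f, hf, rfl⟩ i _
      exact hf.1 _
    · intro f hf f' hf' hW
      rw [← sub_eq_zero]
      refine eq_zero_of_window hq (by rw [map_sub, hf.2, hf'.2, sub_zero]) fun i hi => ?_
      have := congrFun hW ⟨i, hi⟩
      simpa [sub_eq_zero] using this
  obtain ⟨N, hN, h⟩ := exists_pow_fixes hY (s := seqShift) (fun f f' h => by
      ext k
      simpa using congrFun h (k + 1)) (fun f hf => ⟨fun k => hf.1 _, by
      have : Commute (aeval seqShift q) seqShift := by
        have := Commute.map (Commute.all q X) (aeval (R := ℂ) seqShift)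
        rwa [aeval_X] at this
      rw [← Module.End.mul_apply, this.eq, Module.End.mul_apply, hf.2, map_zero]⟩)
  refine ⟨N, hN, fun f hf hqf => ?_⟩
  rw [Module.End.pow_apply]
  exact h f ⟨hf, hqf⟩

/-! ### Periodic sequences and Fourier components -/

lemma aeval_seqShift_comm (p q : ℂ[X]) (f : ℤ → ℂ) :
    aeval seqShift p (aeval seqShift q f) = aeval seqShift q (aeval seqShift p f) := by
  rw [← Module.End.mul_apply, ← map_mul, mul_comm, map_mul, Module.End.mul_apply]

lemma aeval_seqShift_X_pow_sub_one (N : ℕ) (f : ℤ → ℂ) :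
    aeval seqShift (X ^ N - 1 : ℂ[X]) f = 0 ↔ (seqShift ^ N) f = f := by
  rw [map_sub, map_pow, aeval_X, map_one, LinearMap.sub_apply, Module.End.one_apply, sub_eq_zero]

lemma seqShift_pow_eq_of_dvd {M N : ℕ} (h : M ∣ N) {f : ℤ → ℂ} (hf : (seqShift ^ M) f = f) :
    (seqShift ^ N) f = f := by
  obtain ⟨k, rfl⟩ := h
  rw [pow_mul]
  induction k with
  | zero => simp
  | succ k ih => rw [pow_succ, Module.End.mul_apply, hf, ih]

lemma aeval_eigenvector {f : ℤ → ℂ} {z : ℂ} (h : aeval seqShift (X - C z) f = 0) (p : ℂ[X]) :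
    aeval seqShift p f = p.eval z • f := by
  obtain ⟨r, hr⟩ := X_sub_C_dvd_sub_C_eval (a := z) (p := p)
  have h1 : p = (X - C z) * r + C (p.eval z) := by rw [← hr]; ring
  conv_lhs => rw [h1]
  rw [map_add, map_mul, LinearMap.add_apply, Module.End.mul_apply, aeval_seqShift_comm, h, map_zero,
    zero_add, aeval_C, Module.algebraMap_end_apply]

/-- A sequence of period `N` vanishes if all its Fourier components do. -/
lemma eq_zero_of_fourier {N : ℕ} (hN : 0 < N) {f : ℤ → ℂ} (hf : (seqShift ^ N) f = f)
    (h : ∀ z : ℂ, ∀ q : ℂ[X], (X - C z) * q = X ^ N - 1 → aeval seqShift q f = 0) : f = 0 := by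
  classical
  have hprod := X_pow_sub_one_eq_prod hN (Complex.isPrimitiveRoot_exp N hN.ne')
  -- By the product rule the derivative is the sum of the cofactors of the linear factors, each of
  -- which kills `f`. On the other hand `X` times the derivative is `N X^N`, which acts on `f` as
  -- the scalar `N`.
  have hd := congrArg derivative hprod
  rw [derivative_prod_finset] at hd
  have h1 : aeval seqShift (derivative (X ^ N - 1 : ℂ[X])) f = 0 := by
    rw [hd, map_sum, LinearMap.sum_apply]
    refine Finset.sum_eq_zero fun z hz => ?_
    rw [derivative_X_sub_C, mul_one]
    refine h z _ ?_
    rw [hprod, Finset.mul_prod_erase _ (fun z => X - C z) hz]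
  have h2 : aeval seqShift (X * derivative (X ^ N - 1 : ℂ[X])) f = 0 := by
    rw [map_mul, Module.End.mul_apply, h1, map_zero]
  have h3 : X * derivative (X ^ N - 1 : ℂ[X]) = C (N : ℂ) * X ^ N := by
    obtain ⟨n, rfl⟩ := Nat.exists_eq_succ_of_ne_zero hN.ne'
    simp; ring
  rw [h3, map_mul, map_pow, aeval_X, Module.End.mul_apply, hf, aeval_C,
    Module.algebraMap_end_apply] at h2
  exact (smul_eq_zero.mp h2).resolve_left (by exact_mod_cast hN.ne')

/-- A power series `∑ dᵢ sⁱ` whose coefficients are sequences over finite alphabets and that is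
annihilated by `∑ pᵢ sⁱ` has `d₀ = 0`, unless the polynomials `pᵢ` have a common non-zero root. -/
lemma eq_zero_of_convolution_eq_zero {J : ℕ} {p : ℕ → ℂ[X]} (hp0 : p 0 ≠ 0)
    (hp : ∀ z : ℂ, z ≠ 0 → ∃ j < J, (p j).eval z ≠ 0) {A : Set ℂ} (hA : A.Finite)
    {d : ℕ → ℤ → ℂ} (hd : ∀ i k, d i k ∈ A)
    (hpd : ∀ j < J, ∑ i ∈ Finset.range (j + 1), aeval seqShift (p i) (d (j - i)) = 0) :
    d 0 = 0 := by
  -- If `X ^ N - 1` kills the earlier `d i`, applying it to the `j`-th relation leaves `(X ^ N - 1)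
  -- * p 0` killing `d j`. The finite alphabet turns this recurrence into a period.
  have hper : ∀ j ≤ J, ∃ N : ℕ, 0 < N ∧ ∀ i < j, (seqShift ^ N) (d i) = d i := by
    intro j
    induction j with
    | zero => exact fun _ => ⟨1, one_pos, fun i hi => absurd hi (by simp)⟩
    | succ j ih =>
      intro hj
      obtain ⟨N, hN, h⟩ := ih (by omega)
      have hq : (X ^ N - 1) * p 0 ≠ 0 :=
        mul_ne_zero (X_pow_sub_C_ne_zero hN (1 : ℂ)) hp0
      obtain ⟨M, hM, hM'⟩ := exists_period_of_aeval_eq_zero hq hA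
      refine ⟨N * M, Nat.mul_pos hN hM, fun i hi => ?_⟩
      rcases Nat.lt_succ_iff_lt_or_eq.mp hi with hi | rfl
      · exact seqShift_pow_eq_of_dvd (Dvd.intro _ rfl) (h i hi)
      refine seqShift_pow_eq_of_dvd (Dvd.intro_left _ rfl) (hM' _ (hd i) ?_)
      have h1 := congrArg (aeval seqShift (X ^ N - 1 : ℂ[X])) (hpd i (by omega))
      rw [map_zero, map_sum, Finset.sum_range_succ', Finset.sum_eq_zero, zero_add] at h1
      · rwa [map_mul, Module.End.mul_apply]
      · intro l hl
        rw [aeval_seqShift_comm, (aeval_seqShift_X_pow_sub_one N _).mpr (h _ ?_), map_zero]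
        have := Finset.mem_range.mp hl
        omega
  obtain ⟨N, hN, hper⟩ := hper J le_rfl
  have hJ : 0 < J := by
    obtain ⟨j, hj, _⟩ := hp 1 one_ne_zero
    omega
  refine eq_zero_of_fourier hN (hper 0 hJ) fun z q hq => ?_
  have hz : z ≠ 0 := by
    rintro rfl
    have := congrArg (eval 0) hq
    simp [hN.ne'] at this
  have heig : ∀ i < J, ∀ r : ℂ[X],
      aeval seqShift r (aeval seqShift q (d i)) = r.eval z • aeval seqShift q (d i) := fun i hi r =>
    aeval_eigenvector (by
      rw [← Module.End.mul_apply, ← map_mul, hq, aeval_seqShift_X_pow_sub_one, hper i hi]) r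
  classical
  have hex := hp z hz
  -- After projection by `q` to the `z`-eigenspace each `p i` acts as `(p i).eval z`. For the least
  -- `j` with a non-zero value, the `j`-th relation retains only its `d 0` term.
  let j := Nat.find hex
  obtain ⟨hjJ, hj⟩ : j < J ∧ (p j).eval z ≠ 0 := Nat.find_spec hex
  have h1 := congrArg (aeval seqShift q) (hpd j hjJ)
  rw [map_zero, map_sum, Finset.sum_range_succ, Finset.sum_eq_zero, zero_add, Nat.sub_self,
    aeval_seqShift_comm, heig 0 hJ] at h1
  · exact (smul_eq_zero.mp h1).resolve_left hj
  · intro i hi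
    have hij := Finset.mem_range.mp hi
    have : (p i).eval z = 0 := by
      by_contra hne
      exact Nat.find_min hex hij ⟨by omega, hne⟩
    rw [aeval_seqShift_comm, heig _ (by omega), this, zero_smul]

/-! ### The action of Laurent polynomials on configurations -/

/-- The action of the grid on configurations by translations. -/
def translation : Multiplicative (ℤ × ℤ) →* Module.End ℂ (ℤ × ℤ → ℂ) where
  toFun u := LinearMap.funLeft ℂ ℂ fun x => x - u.toAdd
  map_one' := by ext; simp [LinearMap.funLeft_apply]
  map_mul' u w := by
    ext
    simp only [LinearMap.funLeft_apply, Module.End.mul_apply, toAdd_mul]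
    congr 1
    abel

/-- The action of Laurent polynomials on configurations: `X^u` is the translation by `u`. -/
noncomputable def act : Laurent₂ →ₐ[ℂ] Module.End ℂ (ℤ × ℤ → ℂ) :=
  AddMonoidAlgebra.lift ℂ _ _ translation

lemma act_single (u : ℤ × ℤ) (r : ℂ) (c : ℤ × ℤ → ℂ) (x : ℤ × ℤ) :
    act (AddMonoidAlgebra.single u r) c x = r * c (x - u) := by
  simp [act, AddMonoidAlgebra.lift_single, translation, LinearMap.funLeft_apply]

lemma act_apply (f : Laurent₂) (c : ℤ × ℤ → ℂ) (x : ℤ × ℤ) :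
    act f c x = ∑ w ∈ f.coeff.support, f.coeff w * c (x - w) := by
  conv_lhs => rw [← AddMonoidAlgebra.sum_coeff_single f]
  rw [Finsupp.sum, map_sum, LinearMap.sum_apply, Finset.sum_apply]
  exact Finset.sum_congr rfl fun w _ => act_single _ _ _ _

lemma act_comm (f g : Laurent₂) (c : ℤ × ℤ → ℂ) : act f (act g c) = act g (act f c) := by
  rw [← Module.End.mul_apply, ← map_mul, mul_comm, map_mul, Module.End.mul_apply]

/-! ### Coordinates along a primitive direction -/

/-- The map `u ↦ ⟨u, v^⊥⟩`. -/
def perpHom (v : ℤ × ℤ) : ℤ × ℤ →+ ℤ where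
  toFun := perpProd v
  map_zero' := by simp [perpProd]
  map_add' u w := by simp [perpProd]; ring

lemma perpHom_apply (v u : ℤ × ℤ) : perpHom v u = perpProd v u := rfl

@[simp] lemma perpHom_self (v : ℤ × ℤ) : perpHom v v = 0 := by
  simp [perpHom_apply, perpProd, mul_comm]

/-- `α` and `⟨·, v^⊥⟩` are the coordinates with respect to the basis `v`, `w` of the grid. -/
structure IsCoordinate (v w : ℤ × ℤ) (α : ℤ × ℤ →+ ℤ) : Prop where
  self : α v = 1
  other : α w = 0
  perp : perpHom v w = 1
  eq : ∀ u, α u • v + perpHom v u • w = u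

/-- The Bézout coefficients of `v` supply both the coordinate `α` and the complementary basis
vector. -/
lemma IsPrimitive.exists_isCoordinate {v : ℤ × ℤ} (hv : IsPrimitive v) :
    ∃ w α, IsCoordinate v w α := by
  obtain ⟨a, b, h⟩ := hv
  refine ⟨(b, -a), ⟨⟨fun u => a * u.1 + b * u.2, by simp⟩, fun u w => by simp; ring⟩, h, ?_, ?_, ?_⟩
  · change a * b + b * (-a) = 0
    ring
  · change b * v.2 - -a * v.1 = 1
    linarith
  · intro u
    change (a * u.1 + b * u.2) • v + (u.1 * v.2 - u.2 * v.1) • (b, -a) = u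
    ext
    · simp only [Prod.fst_add, Prod.smul_fst, smul_eq_mul]
      linear_combination u.1 * h
    · simp only [Prod.snd_add, Prod.smul_snd, smul_eq_mul]
      linear_combination u.2 * h

lemma IsPrimitive.ne_zero {v : ℤ × ℤ} (hv : IsPrimitive v) : v ≠ 0 := by
  rintro rfl
  obtain ⟨a, b, h⟩ := hv
  simp at h

lemma IsCoordinate.ext_iff {v w : ℤ × ℤ} {α : ℤ × ℤ →+ ℤ} (h : IsCoordinate v w α)
    {x y : ℤ × ℤ} (h1 : α x = α y) (h2 : perpHom v x = perpHom v y) : x = y := by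
  rw [← h.eq x, ← h.eq y, h1, h2]

/-- The evaluation `X^u ↦ z^{α(u)} s^{β(u)}`. -/
noncomputable def evalHom (α β : ℤ × ℤ →+ ℤ) (z : ℂˣ) :
    Laurent₂ →ₐ[ℂ] AddMonoidAlgebra ℂ ℤ :=
  AddMonoidAlgebra.lift ℂ _ _
    { toFun := fun u => AddMonoidAlgebra.single (β u.toAdd) ((z ^ α u.toAdd : ℂˣ) : ℂ)
      map_one' := by
        rw [toAdd_one, map_zero, map_zero, zpow_zero, Units.val_one, AddMonoidAlgebra.one_def]
      map_mul' := fun u w => by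
        rw [AddMonoidAlgebra.single_mul_single, toAdd_mul, map_add, map_add, zpow_add,
          Units.val_mul] }

lemma evalHom_single (α β : ℤ × ℤ →+ ℤ) (z : ℂˣ) (u : ℤ × ℤ) (r : ℂ) :
    evalHom α β z (AddMonoidAlgebra.single u r)
      = AddMonoidAlgebra.single (β u) (r * ((z ^ α u : ℂˣ) : ℂ)) := by
  rw [evalHom, AddMonoidAlgebra.lift_single]
  change r • AddMonoidAlgebra.single (β u) ((z ^ α u : ℂˣ) : ℂ) = _
  rw [AddMonoidAlgebra.smul_single, smul_eq_mul]

/-- No evaluation `X^v ↦ z ≠ 0` makes all `v`-fibers of `f` vanish: `f` has no line polynomial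
factors in direction `v`. -/
def NonVanishing (v : ℤ × ℤ) (f : Laurent₂) : Prop :=
  ∀ α : ℤ × ℤ →+ ℤ, α v = 1 → ∀ z : ℂˣ, evalHom α (perpHom v) z f ≠ 0

lemma NonVanishing.of_mul_left {v : ℤ × ℤ} {f g : Laurent₂} (h : NonVanishing v (f * g)) :
    NonVanishing v g := fun α hα z hz => h α hα z (by rw [map_mul, hz, mul_zero])

lemma aeval_single_eq_sum (v : ℤ × ℤ) (p : ℂ[X]) :
    aeval (AddMonoidAlgebra.single v 1 : Laurent₂) p
      = p.sum fun k a => AddMonoidAlgebra.single (k • v) a := by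
  rw [aeval_def, eval₂_eq_sum]
  congr 1
  ext k a : 2
  simp [AddMonoidAlgebra.single_pow, AddMonoidAlgebra.single_mul_single]

lemma evalHom_aeval {v : ℤ × ℤ} {α β : ℤ × ℤ →+ ℤ} (hβ : β v = 0) (z : ℂˣ) (p : ℂ[X]) :
    evalHom α β z (aeval (AddMonoidAlgebra.single v 1) p)
      = AddMonoidAlgebra.single 0 (p.eval ((z ^ α v : ℂˣ) : ℂ)) := by
  rw [← aeval_algHom_apply, evalHom_single, hβ, one_mul]
  have := aeval_algHom_apply (AddMonoidAlgebra.singleZeroAlgHom (R := ℂ) (A := ℂ) (M := ℤ))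
    ((z ^ α v : ℂˣ) : ℂ) p
  simpa using this

/-- Up to a monomial, a non-zero Laurent polynomial is `∑ⱼ pⱼ(X^v) X^{j w}` with `p₀ ≠ 0`. -/
lemma exists_expansion {v w : ℤ × ℤ} {α : ℤ × ℤ →+ ℤ} (hα : IsCoordinate v w α)
    {f : Laurent₂} (hf : f ≠ 0) :
    ∃ (N : ℤ × ℤ) (J : ℕ) (p : ℕ → ℂ[X]), p 0 ≠ 0 ∧
      AddMonoidAlgebra.single N 1 * f = ∑ j ∈ Finset.range J,
        aeval (AddMonoidAlgebra.single v 1 : Laurent₂) (p j) *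
          AddMonoidAlgebra.single (j • w) 1 := by
  classical
  have hne : f.coeff.support.Nonempty := by
    rw [Finsupp.support_nonempty_iff]
    simpa using hf
  -- The point `x` lies on the lowest line meeting the support, so its coefficient survives in `p
  -- 0`; subtracting `α y` makes the exponents along `v` non-negative.
  obtain ⟨x, hx, hxmin⟩ := f.coeff.support.exists_min_image (perpHom v) hne
  obtain ⟨y, hy, hymin⟩ := f.coeff.support.exists_min_image α hne
  let B : ℤ × ℤ → ℕ := fun u => (perpHom v u - perpHom v x).toNat
  let p : ℕ → ℂ[X] := fun j => ∑ u ∈ f.coeff.support with B u = j,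
    monomial (α u - α y).toNat (f.coeff u)
  refine ⟨-(α y • v + perpHom v x • w), f.coeff.support.sup B + 1, p, ?_, ?_⟩
  · intro h0
    have h1 := congrArg (fun q => q.coeff (α x - α y).toNat) h0
    simp only [p, finsetSum_coeff, coeff_monomial, coeff_zero] at h1
    rw [Finset.sum_eq_single x] at h1
    · rw [if_pos rfl] at h1
      exact Finsupp.mem_support_iff.mp hx h1
    · intro u hu hne
      rw [if_neg]
      intro he
      rw [Finset.mem_filter] at hu
      apply hne
      have h2 := hymin u hu.1
      have h3 := hymin x hx
      have h4 := hxmin u hu.1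
      have h5 := hu.2
      simp only [B] at h5
      exact hα.ext_iff (by omega) (by omega)
    · intro h
      exact absurd (Finset.mem_filter.mpr ⟨hx, by simp [B]⟩) h
  · conv_lhs => rw [← AddMonoidAlgebra.sum_coeff_single f]
    rw [Finsupp.sum, Finset.mul_sum, ← Finset.sum_fiberwise_of_maps_to
      (g := B) (t := Finset.range (f.coeff.support.sup B + 1)) (fun u hu => by
        rw [Finset.mem_range, Nat.lt_succ_iff]
        exact Finset.le_sup hu)]
    refine Finset.sum_congr rfl fun j _ => ?_
    rw [map_sum, Finset.sum_mul]
    refine Finset.sum_congr rfl fun u hu => ?_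
    rw [Finset.mem_filter] at hu
    rw [aeval_single_eq_sum, sum_monomial_index _ _ (by exact AddMonoidAlgebra.single_zero _),
      AddMonoidAlgebra.single_mul_single, AddMonoidAlgebra.single_mul_single, one_mul, mul_one]
    congr 1
    have h2 := hymin u hu.1
    have h4 := hxmin u hu.1
    rw [← hu.2, ← natCast_zsmul, ← natCast_zsmul, Int.toNat_of_nonneg (by omega),
      Int.toNat_of_nonneg (by omega)]
    conv_lhs => rw [← hα.eq u]
    rw [sub_smul, sub_smul]
    abel

/-- The restriction of a configuration to the line `i w + ℤ v`. -/
def lineMap (v w : ℤ × ℤ) (i : ℤ) : (ℤ × ℤ → ℂ) →ₗ[ℂ] (ℤ → ℂ) :=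
  LinearMap.funLeft ℂ ℂ fun k => k • v + i • w

lemma lineMap_apply (v w : ℤ × ℤ) (i : ℤ) (c : ℤ × ℤ → ℂ) (k : ℤ) :
    lineMap v w i c k = c (k • v + i • w) := rfl

/-- Translation by `v` preserves each line and shifts it by one, so `p(X^v)` acts line by line as a
one-dimensional recurrence. -/
lemma lineMap_aeval (v w : ℤ × ℤ) (i : ℤ) (p : ℂ[X]) (c : ℤ × ℤ → ℂ) :
    lineMap v w i (act (aeval (AddMonoidAlgebra.single v 1) p) c)
      = aeval seqShift p (lineMap v w i c) := by
  have h : ∀ c, lineMap v w i (act (AddMonoidAlgebra.single v 1) c)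
      = seqShift (lineMap v w i c) := fun c => by
    ext k
    rw [lineMap_apply, act_single, seqShift_apply, lineMap_apply, one_mul, sub_smul, one_smul]
    congr 1
    abel
  rw [← aeval_algHom_apply]
  induction p using Polynomial.induction_on' with
  | add p q hp hq => rw [map_add, map_add, LinearMap.add_apply, LinearMap.add_apply, map_add, hp, hq]
  | monomial n a =>
    rw [aeval_monomial, aeval_monomial, Module.End.mul_apply, Module.End.mul_apply,
      Module.algebraMap_end_apply, Module.algebraMap_end_apply, map_smul]
    congr 1
    induction n generalizing c with
    | zero => simp
    | succ n ih => rw [pow_succ, pow_succ, Module.End.mul_apply, Module.End.mul_apply, ih, h]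

lemma lineMap_single (v w : ℤ × ℤ) (i : ℤ) (j : ℕ) (c : ℤ × ℤ → ℂ) :
    lineMap v w i (act (AddMonoidAlgebra.single (j • w) 1) c) = lineMap v w (i - j) c := by
  ext k
  rw [lineMap_apply, act_single, lineMap_apply, one_mul, sub_smul, natCast_zsmul]
  congr 1
  abel

/-- A configuration over a finite alphabet annihilated by `f` that vanishes on an open half plane
vanishes on its boundary, if `f` has no line polynomial factors in the direction of the boundary. -/
theorem NonVanishing.eq_zero {v : ℤ × ℤ} (hv : IsPrimitive v) {f : Laurent₂}
    (hf : NonVanishing v f) {A : Set ℂ} (hA : A.Finite) {d : ℤ × ℤ → ℂ} (hd : ∀ x, d x ∈ A)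
    (hfd : act f d = 0) (h0 : ∀ x, perpHom v x < 0 → d x = 0) : d 0 = 0 := by
  obtain ⟨w, α, hα⟩ := hv.exists_isCoordinate
  have hf0 : f ≠ 0 := by
    rintro rfl
    exact hf α hα.self 1 (map_zero _)
  obtain ⟨N, J, p, hp0, hp⟩ := exists_expansion hα hf0
  have h := eq_zero_of_convolution_eq_zero (J := J) hp0 ?_ hA
    (d := fun i => lineMap v w i d) (fun i k => hd _) ?_
  · simpa [lineMap_apply] using congrFun h 0
  · intro z hz
    by_contra hcon
    push Not at hcon
    refine hf α hα.self (Units.mk0 z hz) ?_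
    have h1 := congrArg (evalHom α (perpHom v) (Units.mk0 z hz)) hp
    rw [map_mul, map_sum, Finset.sum_eq_zero] at h1
    · have hu : IsUnit (evalHom α (perpHom v) (Units.mk0 z hz) (AddMonoidAlgebra.single N 1)) :=
        (IsUnit.of_mul_eq_one (AddMonoidAlgebra.single (-N) 1) (by
          simp [AddMonoidAlgebra.single_mul_single, AddMonoidAlgebra.one_def])).map _
      exact (hu.mul_right_eq_zero).mp h1
    · intro j hj
      rw [map_mul, evalHom_aeval (perpHom_self v), hα.self, zpow_one, Units.val_mk0,
        hcon j (Finset.mem_range.mp hj), AddMonoidAlgebra.single_zero, zero_mul]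
  · intro j hj
    have h1 := congrArg (fun g => lineMap v w j (act g d)) hp
    simp only [map_mul, Module.End.mul_apply, hfd, map_zero, map_sum, LinearMap.sum_apply] at h1
    -- The terms with `i > j` read lines of negative index, where `d` vanishes.
    rw [← Finset.sum_subset (Finset.range_subset_range.mpr (Nat.succ_le_of_lt hj))] at h1
    · rw [h1]
      refine Finset.sum_congr rfl fun i hi => ?_
      have := Finset.mem_range.mp hi
      rw [lineMap_aeval, lineMap_single, Nat.cast_sub (by omega)]
    · intro i _ hi
      have hi' : j < i := by simpa using hi
      rw [lineMap_aeval, lineMap_single]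
      have : lineMap v w ((j : ℤ) - i) d = 0 := by
        ext k
        refine h0 _ ?_
        rw [map_add, map_zsmul, map_zsmul, perpHom_self, hα.perp]
        simp
        omega
      rw [this, map_zero]

/-! ### Determinism in all directions implies two-periodicity -/

/-- The real inner product of a grid vector and a vector of the plane. -/
def gridInner (u : ℤ × ℤ) (n : ℝ × ℝ) : ℝ := u.1 * n.1 + u.2 * n.2

/-- The squared length of a grid vector. -/
def normSq (u : ℤ × ℤ) : ℤ := u.1 ^ 2 + u.2 ^ 2

lemma continuous_gridInner (u : ℤ × ℤ) : Continuous (gridInner u) := by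
  unfold gridInner
  fun_prop

lemma isCompact_unitCircle : IsCompact {n : ℝ × ℝ | n.1 ^ 2 + n.2 ^ 2 = 1} := by
  refine Metric.isCompact_of_isClosed_isBounded (isClosed_eq (by fun_prop) (by fun_prop)) ?_
  refine (Metric.isBounded_closedBall (x := (0 : ℝ × ℝ)) (r := 1)).subset fun n hn => ?_
  rw [Set.mem_ofPred_eq] at hn
  rw [mem_closedBall_zero_iff, Prod.norm_def, sup_le_iff, Real.norm_eq_abs, Real.norm_eq_abs,
    abs_le_one_iff_mul_self_le_one, abs_le_one_iff_mul_self_le_one]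
  constructor <;> nlinarith [sq_nonneg n.1, sq_nonneg n.2]

/-- Configurations over the alphabet `A` that are annihilated by `f`. -/
def annihilated (f : Laurent₂) (A : Set ℂ) : Set (ℤ × ℤ → ℂ) :=
  {d | (∀ x, d x ∈ A) ∧ act f d = 0}

/-- By compactness, if the values on `H` determine the value at the origin, then so do the values on
a finite subset of `H`. -/
lemma exists_finset_determining {f : Laurent₂} {A : Set ℂ} (hA : A.Finite) {H : Set (ℤ × ℤ)}
    (h : ∀ d ∈ annihilated f A, (∀ x ∈ H, d x = 0) → d 0 = 0) :
    ∃ F : Finset (ℤ × ℤ), (∀ x ∈ F, x ∈ H) ∧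
      ∀ d ∈ annihilated f A, (∀ x ∈ F, d x = 0) → d 0 = 0 := by
  classical
  -- `K` collects the potential counterexamples. It is compact in the product topology because `A`
  -- is finite, which also makes `A \ {0}` closed, so the condition `d 0 ≠ 0` passes to limits.
  let K : Set (ℤ × ℤ → ℂ) := annihilated f A ∩ {d | d 0 ∈ A \ {0}}
  have hcl : IsClosed {d : ℤ × ℤ → ℂ | act f d = 0 ∧ d 0 ∈ A \ {0}} := by
    refine IsClosed.inter ?_ ((hA.subset Set.sdiff_subset).isClosed.preimage (continuous_apply 0))
    have : {d : ℤ × ℤ → ℂ | act f d = 0} =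
        ⋂ x, {d | ∑ w ∈ f.coeff.support, f.coeff w * d (x - w) = 0} := by
      ext d
      simp only [Set.mem_ofPred_eq, Set.mem_iInter, ← act_apply]
      exact funext_iff
    change IsClosed {d : ℤ × ℤ → ℂ | act f d = 0}
    rw [this]
    exact isClosed_iInter fun x => isClosed_eq (by fun_prop) continuous_const
  have hK : IsCompact K := by
    have : K = (Set.univ.pi fun _ => A) ∩ {d : ℤ × ℤ → ℂ | act f d = 0 ∧ d 0 ∈ A \ {0}} := by
      ext d
      simp [K, annihilated, and_assoc]
    rw [this]
    exact (isCompact_univ_pi fun _ => hA.isCompact).inter_right hcl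
  obtain ⟨F, hF⟩ := hK.elim_finite_subfamily_closed (fun x : H => {d | d x = 0})
    (fun x => isClosed_eq (continuous_apply _) continuous_const) (by
      rw [Set.eq_empty_iff_forall_notMem]
      rintro d ⟨⟨hd, hd0⟩, hd'⟩
      exact hd0.2 (h d hd fun x hx => Set.mem_iInter.mp hd' ⟨x, hx⟩))
  refine ⟨F.image Subtype.val, ?_, fun d hd hd' => ?_⟩
  · intro x hx
    obtain ⟨y, _, rfl⟩ := Finset.mem_image.mp hx
    exact y.2
  · by_contra hne
    have : d ∈ K ∩ ⋂ i ∈ F, {d | d i = 0} := ⟨⟨hd, hd.1 0, hne⟩, by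
      simp only [Set.mem_iInter]
      exact fun x hx => hd' x (Finset.mem_image_of_mem _ hx)⟩
    rw [hF] at this
    exact this

/-- In each direction, the values on the open half plane determine the value at the origin. -/
lemma halfPlane_determines {f : Laurent₂} (hf : f ≠ 0)
    (hE : ∀ v ∈ outerEdgeDirections f, NonVanishing v f) {A : Set ℂ} (hA : A.Finite)
    {n : ℝ × ℝ} (hn : n ≠ 0) {d : ℤ × ℤ → ℂ} (hd : d ∈ annihilated f A)
    (h0 : ∀ x, gridInner x n < 0 → d x = 0) : d 0 = 0 := by
  classical
  have hne : f.coeff.support.Nonempty := by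
    rw [Finsupp.support_nonempty_iff]
    simpa using hf
  obtain ⟨x, hx, hxmin⟩ := f.coeff.support.exists_min_image (fun u => gridInner u n) hne
  have hsub : ∀ u w : ℤ × ℤ, gridInner (u - w) n = gridInner u n - gridInner w n := fun u w => by
    simp [gridInner]; ring
  -- With a unique lowest point `x`, the equation `act f d = 0` at `x` involves `d 0` and otherwise
  -- only values in the open half plane.
  by_cases huniq : ∀ y ∈ f.coeff.support, gridInner y n = gridInner x n → y = x
  · have h1 := congrFun hd.2 x
    rw [act_apply, Finset.sum_eq_single x] at h1
    · rw [sub_self] at h1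
      exact (mul_eq_zero.mp h1).resolve_left (Finsupp.mem_support_iff.mp hx)
    · intro y hy hyx
      rw [h0, mul_zero]
      rw [hsub, sub_neg]
      exact lt_of_le_of_ne (hxmin y hy) fun h => hyx (huniq y hy h.symm)
    · exact fun h => absurd hx h
  · push Not at huniq
    obtain ⟨y, hy, hyx, hne⟩ := huniq
    -- Two lowest points make `n` orthogonal to an integer vector. Dividing by the gcd and choosing
    -- the sign turns `n` into a positive multiple of `v^⊥`.
    obtain ⟨v, lam, hv, hlam, hlamn⟩ : ∃ (v : ℤ × ℤ) (lam : ℝ), IsPrimitive v ∧ 0 < lam ∧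
        ∀ u, gridInner u n = lam * perpProd v u := by
      have h1 : gridInner (y - x) n = 0 := by rw [hsub, hyx, sub_self]
      set u := y - x with hu
      have hu0 : u ≠ 0 := sub_ne_zero.mpr hne
      have hgcd : Int.gcd u.1 u.2 ≠ 0 := by
        intro h
        rw [Int.gcd_eq_zero_iff] at h
        exact hu0 (Prod.ext h.1 h.2)
      obtain ⟨p, q, hpq, hp, hq⟩ := Int.exists_gcd_one (Nat.pos_of_ne_zero hgcd)
      have hcop : IsCoprime p q := Int.isCoprime_iff_gcd_eq_one.mpr hpq
      have h2 : (p : ℝ) * n.1 + q * n.2 = 0 := by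
        have hg : (Int.gcd u.1 u.2 : ℝ) ≠ 0 := by exact_mod_cast hgcd
        refine mul_left_cancel₀ hg ?_
        have hp' : (u.1 : ℝ) = p * (Int.gcd u.1 u.2 : ℝ) := by exact_mod_cast hp
        have hq' : (u.2 : ℝ) = q * (Int.gcd u.1 u.2 : ℝ) := by exact_mod_cast hq
        rw [mul_zero, ← h1, gridInner]
        linear_combination -n.1 * hp' - n.2 * hq'
      obtain ⟨a, b, hab⟩ := hcop
      have hab' : (a : ℝ) * p + b * q = 1 := by exact_mod_cast hab
      let l : ℝ := b * n.1 - a * n.2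
      have hn1 : n.1 = l * q := by simp only [l]; linear_combination (-n.1) * hab' + a * h2
      have hn2 : n.2 = -(l * p) := by simp only [l]; linear_combination (-n.2) * hab' + b * h2
      have hl : l ≠ 0 := by
        intro hl
        apply hn
        ext <;> simp [hn1, hn2, hl]
      rcases lt_or_gt_of_ne hl with hl | hl
      · refine ⟨(-p, -q), -l, ⟨-a, -b, by simpa using hab⟩, by linarith, fun u => ?_⟩
        simp only [gridInner, perpProd, hn1, hn2]
        push_cast
        ring
      · refine ⟨(p, q), l, ⟨a, b, hab⟩, hl, fun u => ?_⟩
        simp only [gridInner, perpProd, hn1, hn2]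
        push_cast
        ring
    have hvE : v ∈ outerEdgeDirections f := by
      refine ⟨hv, x, fun u hu => ?_, ?_⟩
      · have h2 := hxmin u hu
        rw [← sub_nonneg, ← hsub, hlamn] at h2
        exact_mod_cast nonneg_of_mul_nonneg_right h2 hlam
      · have h2 : perpProd v (y - x) = 0 := by
          have h3 : gridInner (y - x) n = 0 := by rw [hsub, hyx, sub_self]
          rw [hlamn] at h3
          exact_mod_cast (mul_eq_zero.mp h3).resolve_left hlam.ne'
        refine Finset.one_lt_card.mpr ⟨y, ?_, x, ?_, hne⟩
        · exact Finset.mem_filter.mpr ⟨hy, h2⟩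
        · exact Finset.mem_filter.mpr ⟨hx, by simp [perpProd]⟩
    refine (hE v hvE).eq_zero hv hA hd.1 hd.2 fun u hu => h0 u ?_
    rw [hlamn]
    exact mul_neg_of_pos_of_neg hlam (by exact_mod_cast hu)

/-- The finite determining sets can be chosen uniformly in all directions. -/
lemma exists_uniform_determining {f : Laurent₂} (hf : f ≠ 0)
    (hE : ∀ v ∈ outerEdgeDirections f, NonVanishing v f) {A : Set ℂ} (hA : A.Finite) :
    ∃ (δ : ℝ) (M : ℤ), 0 < δ ∧ ∀ n : ℝ × ℝ, n.1 ^ 2 + n.2 ^ 2 = 1 → ∃ F : Finset (ℤ × ℤ),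
      (∀ x ∈ F, gridInner x n < -δ ∧ normSq x ≤ M) ∧
      ∀ d ∈ annihilated f A, (∀ x ∈ F, d x = 0) → d 0 = 0 := by
  -- The bounds `δ`, `M` pass to unions, and locally one `F` serves all nearby normals because it
  -- imposes finitely many strict inequalities.
  have key := isCompact_unitCircle.induction_on (p := fun s => ∃ (δ : ℝ) (M : ℤ), 0 < δ ∧
    ∀ n ∈ s, ∃ F : Finset (ℤ × ℤ), (∀ x ∈ F, gridInner x n < -δ ∧ normSq x ≤ M) ∧
      ∀ d ∈ annihilated f A, (∀ x ∈ F, d x = 0) → d 0 = 0) ⟨1, 0, one_pos, by simp⟩ ?_ ?_ ?_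
  · exact key
  · rintro s t hst ⟨δ, M, hδ, h⟩
    exact ⟨δ, M, hδ, fun n hn => h n (hst hn)⟩
  · rintro s t ⟨δ, M, hδ, h⟩ ⟨δ', M', hδ', h'⟩
    refine ⟨min δ δ', max M M', lt_min hδ hδ', ?_⟩
    rintro n (hn | hn)
    · obtain ⟨F, hF, hF'⟩ := h n hn
      refine ⟨F, fun x hx => ⟨(hF x hx).1.trans_le (neg_le_neg (min_le_left _ _)), ?_⟩, hF'⟩
      exact (hF x hx).2.trans (le_max_left _ _)
    · obtain ⟨F, hF, hF'⟩ := h' n hn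
      refine ⟨F, fun x hx => ⟨(hF x hx).1.trans_le (neg_le_neg (min_le_right _ _)), ?_⟩, hF'⟩
      exact (hF x hx).2.trans (le_max_right _ _)
  · intro n hn
    have hn0 : n ≠ 0 := by
      rintro rfl
      simp at hn
    obtain ⟨F, hF, hF'⟩ := exists_finset_determining (f := f) hA (H := {x | gridInner x n < 0})
      fun d hd h => halfPlane_determines hf hE hA hn0 hd h
    obtain ⟨δ, hδ, hFδ⟩ : ∃ δ > 0, ∀ x ∈ F, gridInner x n < -δ := by
      have : ∀ᶠ δ in nhdsWithin (0 : ℝ) (Set.Ioi 0), ∀ x ∈ F, gridInner x n < -δ := by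
        rw [Filter.eventually_all_finset]
        intro x hx
        have hx' : 0 < -gridInner x n := neg_pos.mpr (hF x hx)
        filter_upwards [Ioo_mem_nhdsGT hx'] with δ hδ
        linarith [hδ.2]
      obtain ⟨δ, h1, h2⟩ := (this.and self_mem_nhdsWithin).exists
      exact ⟨δ, h2, h1⟩
    obtain ⟨M, hM⟩ : ∃ M : ℤ, ∀ x ∈ F, normSq x ≤ M := by
      obtain ⟨M, hM⟩ := (F.image normSq).bddAbove
      exact ⟨M, fun x hx => hM (Finset.mem_coe.mpr (Finset.mem_image_of_mem _ hx))⟩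
    refine ⟨{n' | ∀ x ∈ F, gridInner x n' < -δ}, mem_nhdsWithin_of_mem_nhds ?_, δ, M, hδ,
      fun n' hn' => ⟨F, fun x hx => ⟨hn' x hx, hM x hx⟩, hF'⟩⟩
    exact (Filter.eventually_all_finset F).mpr fun x hx =>
      (continuous_gridInner x).continuousAt.eventually_lt continuousAt_const (hFδ x hx)

lemma act_translate (f : Laurent₂) (c : ℤ × ℤ → ℂ) (t x : ℤ × ℤ) :
    act f (fun u => c (u + t)) x = act f c (x + t) := by
  rw [act_apply, act_apply]
  refine Finset.sum_congr rfl fun w _ => ?_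
  congr 2
  abel

/-- A large enough disc determines the whole configuration. -/
lemma exists_disc_determining {f : Laurent₂} (hf : f ≠ 0)
    (hE : ∀ v ∈ outerEdgeDirections f, NonVanishing v f) {A : Set ℂ} (hA : A.Finite) :
    ∃ R : ℤ, ∀ d ∈ annihilated f A, (∀ x, normSq x ≤ R → d x = 0) → d = 0 := by
  obtain ⟨δ, M, hδ, h⟩ := exists_uniform_determining hf hE hA
  -- For `|x| ≥ r` and `u ∈ F`, `|u + x|² ≤ M - 2δr + |x|² < |x|² - 1`. Thus a determining set moved
  -- to `x` lies in the previous disc when the squared radius grows by `1`.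
  obtain ⟨r, hr⟩ := exists_nat_gt ((1 + M) / (2 * δ))
  rw [div_lt_iff₀ (by positivity)] at hr
  refine ⟨(r : ℤ) ^ 2, fun d hd h0 => ?_⟩
  have hstep : ∀ k : ℕ, ∀ x, normSq x ≤ (r : ℤ) ^ 2 + k → d x = 0 := by
    intro k
    induction k with
    | zero => intro x hx; exact h0 x (by simpa using hx)
    | succ k ih =>
      intro x hx
      by_cases hx' : normSq x ≤ (r : ℤ) ^ 2 + k
      · exact ih x hx'
      have hx2 : normSq x = (r : ℤ) ^ 2 + k + 1 := by push_cast at hx; omega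
      have hx3 : ((normSq x : ℤ) : ℝ) = (r : ℝ) ^ 2 + k + 1 := by rw [hx2]; push_cast; ring
      have hx4 : ((normSq x : ℤ) : ℝ) = (x.1 : ℝ) ^ 2 + (x.2 : ℝ) ^ 2 := by simp [normSq]
      set s := Real.sqrt (normSq x) with hs
      have hpos : (0 : ℝ) < normSq x := by rw [hx3]; positivity
      have hs2 : s ^ 2 = normSq x := Real.sq_sqrt hpos.le
      have hs0 : 0 < s := Real.sqrt_pos.mpr hpos
      have hrs : (r : ℝ) ≤ s := by
        refine Real.le_sqrt_of_sq_le ?_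
        rw [hx3]
        have : (0 : ℝ) ≤ k := k.cast_nonneg
        linarith
      obtain ⟨F, hF, hF'⟩ := h (x.1 / s, x.2 / s) (by
        simp only [div_pow]
        rw [← add_div, ← hx4, hs2, div_self hpos.ne'])
      have h1 := hF' (fun u => d (u + x)) ⟨fun u => hd.1 _, by
        ext u
        rw [act_translate, hd.2]
        rfl⟩ fun u hu => ih _ ?_
      · simpa using h1
      · obtain ⟨hu1, hu2⟩ := hF u hu
        have hu3 : (u.1 : ℝ) * x.1 + u.2 * x.2 < -δ * s := by
          have : gridInner u (x.1 / s, x.2 / s) = ((u.1 : ℝ) * x.1 + u.2 * x.2) / s := by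
            simp only [gridInner]
            ring
          rwa [this, div_lt_iff₀ hs0] at hu1
        have hu4 : ((normSq (u + x) : ℤ) : ℝ)
            = normSq u + 2 * ((u.1 : ℝ) * x.1 + u.2 * x.2) + normSq x := by
          simp [normSq]
          ring
        have hu5 : ((normSq u : ℤ) : ℝ) ≤ M := by exact_mod_cast hu2
        have hu6 : δ * r ≤ δ * s := by gcongr
        have : ((normSq (u + x) : ℤ) : ℝ) ≤ (((r : ℤ) ^ 2 + k : ℤ) : ℝ) := by
          push_cast
          linarith
        exact_mod_cast this
  ext x
  refine hstep (normSq x).toNat x ?_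
  have := Int.self_le_toNat (normSq x)
  have := sq_nonneg (r : ℤ)
  omega

lemma finite_disc (R : ℤ) : {x : ℤ × ℤ | normSq x ≤ R}.Finite := by
  refine ((Set.finite_Icc (-R) R).prod (Set.finite_Icc (-R) R)).subset fun x hx => ?_
  have h : x.1 ^ 2 + x.2 ^ 2 ≤ R := hx
  have h1 := Int.le_self_sq x.1
  have h2 := Int.le_self_sq (-x.1)
  have h3 := Int.le_self_sq x.2
  have h4 := Int.le_self_sq (-x.2)
  have h5 := sq_nonneg x.1
  have h6 := sq_nonneg x.2
  simp only [neg_sq, Int.pow_succ] at *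
  exact ⟨⟨by linarith, by linarith⟩, ⟨by linarith, by linarith⟩⟩

/-- Configurations over a finite alphabet that `f` maps to a constant configuration are two-periodic,
if `f` has no line polynomial factors. -/
theorem isTwoPeriodic_of_nonVanishing {f : Laurent₂} (hf : f ≠ 0)
    (hE : ∀ v ∈ outerEdgeDirections f, NonVanishing v f) {A : Set ℂ} (hA : A.Finite) {κ : ℂ}
    {c : ℤ × ℤ → ℂ} (hc : ∀ x, c x ∈ A) (hfc : ∀ x, act f c x = κ) : IsTwoPeriodic c := by
  let Y : Set (ℤ × ℤ → ℂ) := {c | (∀ x, c x ∈ A) ∧ ∀ x, act f c x = κ}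
  have hY : Y.Finite := by
    -- The difference of two solutions is annihilated by `f` and takes values in `A - A`.
    obtain ⟨R, hR⟩ := exists_disc_determining hf hE (hA.sub hA)
    have := (finite_disc R).to_subtype
    let W : (ℤ × ℤ → ℂ) → ({x : ℤ × ℤ | normSq x ≤ R} → ℂ) := fun c x => c x
    have hfin : (Set.pi Set.univ fun _ : {x : ℤ × ℤ | normSq x ≤ R} => A).Finite :=
      Set.Finite.pi fun _ => hA
    refine Set.Finite.of_finite_image (f := W) (hfin.subset ?_) ?_
    · rintro _ ⟨c, hc, rfl⟩ x _
      exact hc.1 _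
    · intro c hc c' hc' hW
      rw [← sub_eq_zero]
      refine hR _ ⟨fun x => Set.sub_mem_sub (hc.1 x) (hc'.1 x), ?_⟩ fun x hx => ?_
      · ext x
        simp [map_sub, hc.2, hc'.2]
      · exact sub_eq_zero.mpr (congrFun hW ⟨x, hx⟩)
  have hper : ∀ t : ℤ × ℤ, ∃ N : ℕ, 0 < N ∧ IsPeriodicBy c (N • t) := by
    intro t
    obtain ⟨N, hN, h⟩ := exists_pow_fixes hY (s := fun c x => c (x + -t)) (fun c c' h => by
        ext x
        simpa using congrFun h (x + t)) (fun c hc => ⟨fun x => hc.1 _, fun x => by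
        rw [act_translate]; exact hc.2 _⟩)
    refine ⟨N, hN, fun u => ?_⟩
    have hiter : ∀ n : ℕ, ∀ c : ℤ × ℤ → ℂ, ∀ u,
        (fun (c : ℤ × ℤ → ℂ) x => c (x + -t))^[n] c u = c (u - n • t) := by
      intro n
      induction n with
      | zero => simp
      | succ n ih =>
        intro c u
        rw [Function.iterate_succ_apply, ih, succ_nsmul]
        congr 1
        abel
    rw [← hiter N c u, h c ⟨hc, hfc⟩]
  obtain ⟨M, hM, hM'⟩ := hper (1, 0)
  obtain ⟨N, hN, hN'⟩ := hper (0, 1)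
  refine ⟨M • (1, 0), N • (0, 1), ?_, hM', hN'⟩
  rw [LinearIndependent.pair_iff]
  intro a b hab
  have h1 := congrArg Prod.fst hab
  have h2 := congrArg Prod.snd hab
  simp at h1 h2
  exact ⟨h1.resolve_right hM.ne', h2.resolve_right hN.ne'⟩

/-! ### Line polynomial factors in a single direction -/

/-- Here `w = α(w) v`, and a Bézout relation for `w` makes the integer `α(w)` a unit. -/
lemma IsPrimitive.eq_or_eq_neg_of_parallel {v w : ℤ × ℤ} (hv : IsPrimitive v)
    (hw : IsPrimitive w) (h : Parallel v w) : ∃ ε : ℤˣ, w = (ε : ℤ) • v := by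
  obtain ⟨x, α, hα⟩ := hv.exists_isCoordinate
  obtain ⟨q, h1, h2⟩ := h
  have hp : perpHom v w = 0 := by
    have : ((w.1 * v.2 - w.2 * v.1 : ℤ) : ℚ) = 0 := by
      push_cast
      rw [h1, h2]
      ring
    exact_mod_cast this
  have hw' := hα.eq w
  rw [hp, zero_smul, add_zero] at hw'
  obtain ⟨a, b, hab⟩ := hw
  have hu : IsUnit (α w) := by
    refine IsUnit.of_mul_eq_one (a * v.1 + b * v.2) ?_
    have e1 : α w * v.1 = w.1 := congrArg Prod.fst hw'
    have e2 : α w * v.2 = w.2 := congrArg Prod.snd hw'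
    linear_combination hab + a * e1 + b * e2
  exact ⟨hu.unit, hw'.symm⟩

/-- A vector that is not an outer edge direction is not the direction of a line polynomial factor. -/
lemma nonVanishing_of_notMem {v : ℤ × ℤ} (hv : IsPrimitive v) {f : Laurent₂} (hf : f ≠ 0)
    (h : v ∉ outerEdgeDirections f) : NonVanishing v f := by
  classical
  intro α hα z hz
  have hne : f.coeff.support.Nonempty := by
    rw [Finsupp.support_nonempty_iff]
    simpa using hf
  obtain ⟨x, hx, hxmin⟩ := f.coeff.support.exists_min_image (perpHom v) hne
  -- A second point on the lowest line would make `v` an outer edge direction. The lowest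
  -- coefficient of any evaluation is thus a single non-zero term.
  have huniq : ∀ y ∈ f.coeff.support, perpHom v y = perpHom v x → y = x := by
    intro y hy hyx
    by_contra hne
    refine h ⟨hv, x, fun u hu => ?_, Finset.one_lt_card.mpr ⟨y, ?_, x, ?_, hne⟩⟩
    · rw [← perpHom_apply, map_sub, sub_nonneg]
      exact hxmin u hu
    · exact Finset.mem_filter.mpr ⟨hy, by rw [← perpHom_apply, map_sub, hyx, sub_self]⟩
    · exact Finset.mem_filter.mpr ⟨hx, by rw [← perpHom_apply, map_sub, sub_self]⟩
  have h1 := congrArg (fun g => g.coeff (perpHom v x)) hz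
  rw [← AddMonoidAlgebra.sum_coeff_single f, Finsupp.sum, map_sum] at h1
  simp only [evalHom_single, AddMonoidAlgebra.coeff_sum, AddMonoidAlgebra.coeff_single,
    Finsupp.finsetSum_apply, Finsupp.single_apply] at h1
  rw [Finset.sum_eq_single x] at h1
  · rw [if_pos rfl] at h1
    exact mul_ne_zero (Finsupp.mem_support_iff.mp hx) (Units.ne_zero _) h1
  · intro y hy hyx
    rw [if_neg fun h => hyx (huniq y hy h)]
  · exact fun h => absurd hx h

/-- All line polynomial factors in a given direction can be split off. -/
lemma exists_factorization {v : ℤ × ℤ} (hv : IsPrimitive v) {f : Laurent₂} (hf : f ≠ 0) :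
    ∃ (q : ℂ[X]) (φ h : Laurent₂) (N : ℤ × ℤ), q ≠ 0 ∧ φ = aeval (AddMonoidAlgebra.single v 1) q ∧
      AddMonoidAlgebra.single N 1 * f = φ * h ∧
      ∀ ε : ℤˣ, NonVanishing ((ε : ℤ) • v) h := by
  classical
  obtain ⟨w, α, hα⟩ := hv.exists_isCoordinate
  obtain ⟨N, J, p, hp0, hp⟩ := exists_expansion hα hf
  have hJ : 0 < J := by
    rcases Nat.eq_zero_or_pos J with rfl | hJ
    · exfalso
      rw [Finset.range_zero, Finset.sum_empty] at hp
      apply hf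
      have := congrArg (AddMonoidAlgebra.single (-N) (1 : ℂ) * ·) hp
      simpa [← mul_assoc, AddMonoidAlgebra.single_mul_single, ← AddMonoidAlgebra.one_def] using this
    · exact hJ
  -- The gcd of the `p j` gathers all factors in direction `v`; the cofactors `r j` have gcd `1`,
  -- hence no common root.
  obtain ⟨r, hr, hgcd⟩ := Finset.extract_gcd p (Finset.nonempty_range_iff.mpr hJ.ne')
  set q := (Finset.range J).gcd p with hq
  refine ⟨q, _, ∑ j ∈ Finset.range J, aeval (AddMonoidAlgebra.single v 1 : Laurent₂) (r j) *
    AddMonoidAlgebra.single (j • w) 1, N, ?_, rfl, ?_, ?_⟩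
  · intro h0
    exact hp0 (by rw [hr 0 (Finset.mem_range.mpr hJ), h0, zero_mul])
  · rw [hp, Finset.mul_sum]
    refine Finset.sum_congr rfl fun j hj => ?_
    rw [hr j hj, map_mul, mul_assoc]
  · intro ε β hβ z hz
    have hperp : ∀ u, perpHom ((ε : ℤ) • v) u = ε * perpHom v u := fun u => by
      simp [perpHom_apply, perpProd]
      ring
    have hroot : ∀ j ∈ Finset.range J, (r j).eval ((z ^ β v : ℂˣ) : ℂ) = 0 := by
      intro j hj
      have h1 := congrArg (fun g => g.coeff ((ε : ℤ) * j)) hz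
      simp only [map_sum, map_mul] at h1
      rw [AddMonoidAlgebra.coeff_sum, Finsupp.finsetSum_apply, Finset.sum_eq_single j] at h1
      · rw [evalHom_aeval (by rw [hperp, perpHom_self, mul_zero]), evalHom_single,
          AddMonoidAlgebra.single_mul_single, hperp, map_nsmul, hα.perp, zero_add,
          AddMonoidAlgebra.coeff_single, nsmul_one, Finsupp.single_eq_same, one_mul] at h1
        exact (mul_eq_zero.mp h1).resolve_right (Units.ne_zero _)
      · intro i _ hij
        rw [evalHom_aeval (by rw [hperp, perpHom_self, mul_zero]), evalHom_single,
          AddMonoidAlgebra.single_mul_single, hperp, map_nsmul, hα.perp, zero_add,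
          AddMonoidAlgebra.coeff_single, nsmul_one, Finsupp.single_apply, if_neg]
        intro h
        have := mul_left_cancel₀ ε.ne_zero h
        exact hij (by exact_mod_cast this)
      · exact fun h => absurd hj h
    have hdvd : X - C ((z ^ β v : ℂˣ) : ℂ) ∣ (Finset.range J).gcd r :=
      Finset.dvd_gcd fun j hj => dvd_iff_isRoot.mpr (hroot j hj)
    rw [hgcd] at hdvd
    exact not_isUnit_X_sub_C _ (isUnit_of_dvd_one hdvd)

/-- Keeps the alphabet finite when a factor of the polynomial is applied to the configuration. -/
lemma finite_range_act {A : Set ℂ} (hA : A.Finite) (f : Laurent₂) :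
    ∃ B : Set ℂ, B.Finite ∧ ∀ c : ℤ × ℤ → ℂ, (∀ x, c x ∈ A) → ∀ x, act f c x ∈ B := by
  classical
  let W : (f.coeff.support → ℂ) → ℂ := fun y => ∑ w : f.coeff.support, f.coeff w * y w
  refine ⟨W '' (Set.univ.pi fun _ => A), (Set.Finite.pi fun _ => hA).image _, fun c hc x => ?_⟩
  refine ⟨fun w => c (x - w), fun _ _ => hc _, ?_⟩
  rw [act_apply, ← Finset.sum_coe_sort]

/-! ### The group of periods -/

lemma IsTwoPeriodic.isPeriodic {B : Type*} {c : ℤ × ℤ → B} (h : IsTwoPeriodic c) :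
    IsPeriodic c := by
  obtain ⟨s, t, hst, hs, _⟩ := h
  exact ⟨s, hst.ne_zero 0, hs⟩

lemma IsPeriodicBy.nsmul {B : Type*} {c : ℤ × ℤ → B} {t : ℤ × ℤ} (h : IsPeriodicBy c t) (n : ℕ) :
    IsPeriodicBy c (n • t) := by
  induction n with
  | zero => intro u; simp
  | succ n ih => intro u; rw [succ_nsmul, ← sub_sub, h, ih]

lemma IsPeriodicBy.neg {B : Type*} {c : ℤ × ℤ → B} {t : ℤ × ℤ} (h : IsPeriodicBy c t) :
    IsPeriodicBy c (-t) := fun u => by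
  rw [← h (u - -t)]
  simp

lemma IsPeriodicBy.zsmul {B : Type*} {c : ℤ × ℤ → B} {t : ℤ × ℤ} (h : IsPeriodicBy c t) (n : ℤ) :
    IsPeriodicBy c (n • t) := by
  obtain ⟨n, rfl | rfl⟩ := n.eq_nat_or_neg
  · rw [natCast_zsmul]
    exact h.nsmul n
  · rw [neg_smul, natCast_zsmul]
    exact (h.nsmul n).neg

lemma IsPeriodicBy.add {B : Type*} {c : ℤ × ℤ → B} {s t : ℤ × ℤ} (hs : IsPeriodicBy c s)
    (ht : IsPeriodicBy c t) : IsPeriodicBy c (s + t) := fun u => by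
  rw [← sub_sub, ht, hs]

/-- A two-periodic configuration is periodic in every direction. -/
lemma IsTwoPeriodic.exists_nsmul {B : Type*} {c : ℤ × ℤ → B} (h : IsTwoPeriodic c) (v : ℤ × ℤ) :
    ∃ N : ℕ, 0 < N ∧ IsPeriodicBy c (N • v) := by
  obtain ⟨s, t, hst, hs, ht⟩ := h
  have hdet : perpProd t s ≠ 0 := by
    intro h0
    unfold perpProd at h0
    rw [LinearIndependent.pair_iff] at hst
    by_cases h2 : t.2 = 0 ∧ s.2 = 0
    · have h3 := hst t.1 (-s.1) (by ext <;> simp [h2.1, h2.2, mul_comm])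
      have : t = 0 := Prod.ext h3.1 h2.1
      subst this
      exact one_ne_zero (hst 0 1 (by simp)).2
    · have h3 := hst t.2 (-s.2) (by
        ext
        · simp
          linarith
        · simp [mul_comm])
      exact h2 ⟨h3.1, neg_eq_zero.mp h3.2⟩
  have key : IsPeriodicBy c (perpProd t s • v) := by
    -- Cramer's rule for `v` in terms of `s` and `t`.
    have : perpProd t s • v = perpProd t v • s + perpProd v s • t := by
      ext <;> simp [perpProd] <;> ring
    rw [this]
    exact (hs.zsmul _).add (ht.zsmul _)
  refine ⟨(perpProd t s).natAbs, Int.natAbs_pos.mpr hdet, ?_⟩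
  rcases Int.natAbs_eq (perpProd t s) with h | h
  · rw [← natCast_zsmul, ← h]
    exact key
  · have h' : ((perpProd t s).natAbs : ℤ) = -perpProd t s := by omega
    rw [← natCast_zsmul, h', neg_smul]
    exact key.neg

/-- A configuration over a finite alphabet annihilated by a line polynomial is periodic. -/
lemma isPeriodic_of_act_aeval_eq_zero {v : ℤ × ℤ} (hv : IsPrimitive v) {q : ℂ[X]} (hq : q ≠ 0)
    {A : Set ℂ} (hA : A.Finite) {c : ℤ × ℤ → ℂ} (hc : ∀ x, c x ∈ A)
    (h : act (aeval (AddMonoidAlgebra.single v 1) q) c = 0) : IsPeriodic c := by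
  obtain ⟨w, α, hα⟩ := hv.exists_isCoordinate
  obtain ⟨N, hN, hper⟩ := exists_period_of_aeval_eq_zero hq hA
  refine ⟨N • v, smul_ne_zero hN.ne' hv.ne_zero, fun u => ?_⟩
  have h1 := hper (lineMap v w (perpHom v u) c) (fun k => hc _) (by
    rw [← lineMap_aeval, h, map_zero])
  have h2 := congrFun h1 (α u)
  rw [seqShift_pow_apply, lineMap_apply, lineMap_apply, hα.eq, sub_smul] at h2
  rw [← h2]
  congr 1
  conv_lhs => rw [← hα.eq u]
  rw [natCast_zsmul]
  abel

/-- Configurations over a finite alphabet that `f` maps to a constant configuration are periodic,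
if all line polynomial factors of `f` are in parallel directions. -/
theorem isPeriodic_of_nonVanishing {f : Laurent₂} (hf : f ≠ 0)
    (hE : ∀ v ∈ outerEdgeDirections f, ∀ w ∈ outerEdgeDirections f,
      ¬ NonVanishing v f → ¬ NonVanishing w f → Parallel v w) {A : Set ℂ} (hA : A.Finite) {κ : ℂ}
    {c : ℤ × ℤ → ℂ} (hc : ∀ x, c x ∈ A) (hfc : ∀ x, act f c x = κ) : IsPeriodic c := by
  by_cases hall : ∀ v ∈ outerEdgeDirections f, NonVanishing v f
  · exact (isTwoPeriodic_of_nonVanishing hf hall hA hc hfc).isPeriodic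
  push Not at hall
  obtain ⟨v, hv, hvf⟩ := hall
  obtain ⟨q, φ, h, N, hq, hφ, hfac, hh⟩ := exists_factorization hv.1 hf
  have hunit : (AddMonoidAlgebra.single (-N) 1 : Laurent₂) * AddMonoidAlgebra.single N 1 = 1 := by
    simp [AddMonoidAlgebra.single_mul_single, AddMonoidAlgebra.one_def]
  have hf' : f = AddMonoidAlgebra.single (-N) 1 * φ * h := by
    rw [mul_assoc, ← hfac, ← mul_assoc, hunit, one_mul]
  have hh0 : h ≠ 0 := by
    rintro rfl
    exact hf (by rw [hf', mul_zero])
  obtain ⟨B, hB, hB'⟩ := finite_range_act hA φ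
  have htwo : IsTwoPeriodic (act φ c) := by
    refine isTwoPeriodic_of_nonVanishing (f := h) (κ := κ) hh0 ?_ hB (hB' c hc) fun x => ?_
    -- Directions `±v` are covered by the factorization. In any other direction `f` itself has no
    -- line factor, and neither does its divisor `h`.
    · intro w hw
      by_cases hpar : Parallel v w
      · obtain ⟨ε, rfl⟩ := hv.1.eq_or_eq_neg_of_parallel hw.1 hpar
        exact hh ε
      · refine NonVanishing.of_mul_left (f := AddMonoidAlgebra.single (-N) 1 * φ) ?_
        rw [← hf']
        by_cases hwE : w ∈ outerEdgeDirections f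
        · by_contra hwf
          exact hpar (hE v hv w hwE hvf hwf)
        · exact nonVanishing_of_notMem hw.1 hf hwE
    · rw [act_comm, ← Module.End.mul_apply, ← map_mul, ← hfac, map_mul, Module.End.mul_apply,
        act_single, one_mul, hfc]
  obtain ⟨M, hM, hMper⟩ := htwo.exists_nsmul v
  refine isPeriodic_of_act_aeval_eq_zero hv.1 (q := (X ^ M - 1) * q)
    (mul_ne_zero (X_pow_sub_C_ne_zero hM (1 : ℂ)) hq) hA hc ?_
  rw [map_mul, ← hφ, map_mul, Module.End.mul_apply, map_sub, map_pow, aeval_X, map_one, map_sub,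
    LinearMap.sub_apply, map_one, Module.End.one_apply, sub_eq_zero]
  ext u
  rw [AddMonoidAlgebra.single_pow, one_pow, act_single, one_mul]
  exact hMper u

/-! ### Normal forms of fibers and line polynomial factors -/

lemma evalHom_apply (α β : ℤ × ℤ →+ ℤ) (z : ℂˣ) (f : Laurent₂) :
    evalHom α β z f = f.coeff.sum fun x r =>
      AddMonoidAlgebra.single (β x) (r * ((z ^ α x : ℂˣ) : ℂ)) := by
  conv_lhs => rw [← AddMonoidAlgebra.sum_coeff_single f]
  rw [Finsupp.sum, map_sum, Finsupp.sum]
  exact Finset.sum_congr rfl fun x _ => evalHom_single _ _ _ _ _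

lemma linePoly_eq (v w : ℤ × ℤ) (p : ℂ[X]) :
    linePoly v w p = AddMonoidAlgebra.single w 1 * aeval (AddMonoidAlgebra.single v 1) p := by
  rw [aeval_single_eq_sum, linePoly, Polynomial.sum, Polynomial.sum, Finset.mul_sum]
  refine Finset.sum_congr rfl fun k _ => ?_
  rw [AddMonoidAlgebra.single_mul_single, one_mul]

lemma IsPrimitive.exists_eq_add_smul_iff {v : ℤ × ℤ} (hv : IsPrimitive v) (u x : ℤ × ℤ) :
    (∃ k : ℤ, x = u + k • v) ↔ perpHom v x = perpHom v u := by
  obtain ⟨w, α, hα⟩ := hv.exists_isCoordinate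
  constructor
  · rintro ⟨k, rfl⟩
    rw [map_add, map_zsmul, perpHom_self, smul_zero, add_zero]
  · intro h
    refine ⟨α x - α u, ?_⟩
    conv_lhs => rw [← hα.eq x, h]
    conv_rhs => enter [1]; rw [← hα.eq u]
    rw [sub_smul]
    abel

/-- If an evaluation makes `f` vanish, then it makes all the fibers of `f` vanish. -/
lemma eval_normalForm_fiber {v : ℤ × ℤ} (hv : IsPrimitive v) {f : Laurent₂} {α : ℤ × ℤ →+ ℤ}
    (hα : α v = 1) {z : ℂˣ} (hz : evalHom α (perpHom v) z f = 0) (u : ℤ × ℤ) :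
    (normalForm v (fiber v u f)).eval (z : ℂ) = 0 := by
  classical
  by_cases h0 : fiber v u f = 0
  · rw [h0, normalForm_zero v hv.ne_zero, eval_zero]
  obtain ⟨p, hp⟩ := exists_isNormalForm_fiber hv.ne_zero u f h0
  rw [normalForm_eq hv.ne_zero hp]
  obtain ⟨-, w, hw⟩ := hp
  have h1 : evalHom α (perpHom v) z (fiber v u f) = 0 := by
    ext i
    have h2 := congrArg (fun g => g.coeff i) hz
    rw [evalHom_apply, Finsupp.sum, AddMonoidAlgebra.coeff_sum, Finsupp.finsetSum_apply] at h2 ⊢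
    change ∑ x ∈ (f.coeff.filter fun w => ∃ k : ℤ, w = u + k • v).support, _ = _
    rw [Finsupp.support_filter, Finset.sum_filter]
    -- Distinct fibers are evaluated into distinct degrees, so the coefficient at `perpHom v u` sees
    -- exactly the fiber through `u`.
    by_cases hi : i = perpHom v u
    · rw [← h2]
      refine Finset.sum_congr rfl fun x _ => ?_
      split_ifs with hx
      · simp only [fiber, Finsupp.filter_apply, if_pos hx]
      · rw [hv.exists_eq_add_smul_iff] at hx
        rw [AddMonoidAlgebra.coeff_single, Finsupp.single_apply, if_neg]
        rw [hi]
        exact hx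
    · rw [AddMonoidAlgebra.coeff_zero, Finsupp.zero_apply]
      refine Finset.sum_eq_zero fun x _ => ?_
      split_ifs with hx
      · rw [hv.exists_eq_add_smul_iff] at hx
        rw [AddMonoidAlgebra.coeff_single, Finsupp.single_apply, if_neg]
        rw [hx]
        exact fun h => hi h.symm
      · rfl
  rw [hw, linePoly_eq, map_mul, evalHom_aeval (perpHom_self v), evalHom_single,
    AddMonoidAlgebra.single_mul_single, hα, zpow_one, AddMonoidAlgebra.single_eq_zero, one_mul] at h1
  exact (mul_eq_zero.mp h1).resolve_left (Units.ne_zero _)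

lemma phi_one : phi 1 = 1 := by simp [phi]

/-- A common root of the polynomials in `F` is a root of `φ_d`, where `d` is the greatest common
divisor of the numbers `n` with `φ_n ∈ F`. -/
lemma eval_phi_lengthGcd {F : Set ℂ[X]} {z : ℂ} (h : ∀ p ∈ F, p.eval z = 0) :
    (phi (lengthGcd F)).eval z = 0 := by
  -- Since `φ_n(1) = n`, the root `z = 1` leaves no `φ_n` with `n ≥ 1` in `F`; then the gcd is `0`
  -- and `φ_0 = 0`. For `z ≠ 1`, `φ_n(z) = 0` means that the order of `z` divides `n`, with order
  -- `0` if `z` is not a root of unity.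
  by_cases hz : z = 1
  · have h0 : lengthGcd F = 0 := by
      rw [← zero_dvd_iff, lengthGcd, dvd_setGcd_iff]
      rintro n ⟨hn, hnF⟩
      have h1 := h _ hnF
      rw [hz] at h1
      simp [phi, eval_finsetSum] at h1
      omega
    simp [h0, phi]
  · have hpow : ∀ n, (phi n).eval z = 0 ↔ z ^ n = 1 := by
      intro n
      have h1 : (phi n).eval z * (z - 1) = z ^ n - 1 := by
        rw [phi, eval_finsetSum, ← geom_sum_mul]
        simp
      rw [← sub_eq_zero (a := z ^ n), ← h1, mul_eq_zero_iff_right (sub_ne_zero.mpr hz)]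
    rw [hpow, ← orderOf_dvd_iff_pow_eq_one, lengthGcd, dvd_setGcd_iff]
    rintro n ⟨-, hn⟩
    rw [orderOf_dvd_iff_pow_eq_one, ← hpow]
    exact h _ hn

lemma nonVanishing_of_lengthGcd_eq_one {v : ℤ × ℤ} (hv : IsPrimitive v) {f : Laurent₂}
    (h : lengthGcd (fiberForms v f) = 1) : NonVanishing v f := by
  intro α hα z hz
  have h1 : (phi (lengthGcd (fiberForms v f))).eval (z : ℂ) = 0 := by
    refine eval_phi_lengthGcd ?_
    rintro _ ⟨u, _, rfl⟩
    exact eval_normalForm_fiber hv hα hz u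
  rw [h, phi_one, eval_one] at h1
  exact one_ne_zero h1

/-- A bad `z` would give the common factor `X - z` of `φ_d` and the origin form. -/
lemma nonVanishing_of_originCondition {v : ℤ × ℤ} (hv : IsPrimitive v) {f : Laurent₂}
    (h : OriginCondition v f) : NonVanishing v f := by
  intro α hα z hz
  refine not_isUnit_X_sub_C (z : ℂ) (h (dvd_iff_isRoot.mpr ?_) (dvd_iff_isRoot.mpr ?_))
  · refine eval_phi_lengthGcd ?_
    rintro _ ⟨u, _, _, rfl⟩
    exact eval_normalForm_fiber hv hα hz u
  · exact eval_normalForm_fiber hv hα hz 0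

/-! ### Coverings -/

/-- The complex-valued configuration with the same colours. -/
def toComplex (c : ℤ × ℤ → Fin 2) (x : ℤ × ℤ) : ℂ := if c x = 1 then 1 else 0

lemma toComplex_mem (c : ℤ × ℤ → Fin 2) (x : ℤ × ℤ) : toComplex c x ∈ ({0, 1} : Set ℂ) := by
  unfold toComplex
  split_ifs <;> simp

lemma isPeriodicBy_toComplex {c : ℤ × ℤ → Fin 2} {t : ℤ × ℤ} (h : IsPeriodicBy (toComplex c) t) :
    IsPeriodicBy c t := fun u => by
  have h1 := h u
  have h2 : c (u - t) = 1 ↔ c u = 1 := by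
    unfold toComplex at h1
    split_ifs at h1 <;> simp_all
  omega

/-- Subtracting `b - a` times the colour corrects the count `b` at cells of colour `1` to `a`, the
count at cells of colour `0`. -/
lemma IsCovering.act_eq {D : Finset (ℤ × ℤ)} {b a : ℕ} {c : ℤ × ℤ → Fin 2}
    (hc : IsCovering D b a c) (x : ℤ × ℤ) : act (coveringPoly D b a) (toComplex c) x = a := by
  have h1 : act (charPoly D) (toComplex c) x
      = ((D.filter fun w => c (x + w) = 1).card : ℂ) := by
    rw [charPoly, map_sum, LinearMap.sum_apply, Finset.sum_apply, Finset.card_filter]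
    push_cast
    refine Finset.sum_congr rfl fun w _ => ?_
    rw [act_single, one_mul, sub_neg_eq_add, toComplex]
  rw [coveringPoly, map_sub, LinearMap.sub_apply, Pi.sub_apply, h1, hc x, act_single, sub_zero,
    toComplex]
  split_ifs <;> simp

lemma IsCovering.isTwoPeriodic {D : Finset (ℤ × ℤ)} {b a : ℕ} {c : ℤ × ℤ → Fin 2}
    (hc : IsCovering D b a c) (hg : coveringPoly D b a ≠ 0)
    (hE : ∀ v ∈ outerEdgeDirections (coveringPoly D b a), NonVanishing v (coveringPoly D b a)) :
    IsTwoPeriodic c := by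
  obtain ⟨s, t, hst, hs, ht⟩ := isTwoPeriodic_of_nonVanishing hg hE
    (Set.toFinite {0, 1}) (toComplex_mem c) hc.act_eq
  exact ⟨s, t, hst, isPeriodicBy_toComplex hs, isPeriodicBy_toComplex ht⟩

lemma IsCovering.isPeriodic {D : Finset (ℤ × ℤ)} {b a : ℕ} {c : ℤ × ℤ → Fin 2}
    (hc : IsCovering D b a c) (hg : coveringPoly D b a ≠ 0)
    (hE : ∀ v ∈ outerEdgeDirections (coveringPoly D b a),
      ∀ w ∈ outerEdgeDirections (coveringPoly D b a), ¬ NonVanishing v (coveringPoly D b a) →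
        ¬ NonVanishing w (coveringPoly D b a) → Parallel v w) : IsPeriodic c := by
  obtain ⟨t, ht0, ht⟩ := isPeriodic_of_nonVanishing hg hE
    (Set.toFinite {0, 1}) (toComplex_mem c) hc.act_eq
  exact ⟨t, ht0, isPeriodicBy_toComplex ht⟩

end PerfectCovering

open PerfectCovering in
theorem mainTheorem5 (D : Finset (ℤ × ℤ)) (hD : IsConvexShape D) (b a : ℕ)
    (hg : coveringPoly D b a ≠ 0) :
    (b = a →
      ((∀ v ∈ outerEdgeDirections (coveringPoly D b a),
            lengthGcd (fiberForms v (coveringPoly D b a)) = 1) →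
          ∀ c : ℤ × ℤ → Fin 2, IsCovering D b a c → IsTwoPeriodic c) ∧
      ((∀ v ∈ outerEdgeDirections (coveringPoly D b a),
          ∀ w ∈ outerEdgeDirections (coveringPoly D b a),
            lengthGcd (fiberForms v (coveringPoly D b a)) ≠ 1 →
            lengthGcd (fiberForms w (coveringPoly D b a)) ≠ 1 → Parallel v w) →
          ∀ c : ℤ × ℤ → Fin 2, IsCovering D b a c → IsPeriodic c)) ∧
    (b ≠ a →
      ((∀ v ∈ outerEdgeDirections (coveringPoly D b a),
            OriginCondition v (coveringPoly D b a)) →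
          ∀ c : ℤ × ℤ → Fin 2, IsCovering D b a c → IsTwoPeriodic c) ∧
      ((∀ v ∈ outerEdgeDirections (coveringPoly D b a),
          ∀ w ∈ outerEdgeDirections (coveringPoly D b a),
            ¬ OriginCondition v (coveringPoly D b a) →
            ¬ OriginCondition w (coveringPoly D b a) → Parallel v w) →
          ∀ c : ℤ × ℤ → Fin 2, IsCovering D b a c → IsPeriodic c) ∧
      (∀ v ∈ outerEdgeDirections (coveringPoly D b a),
          lengthGcd (fiberForms' v (coveringPoly D b a)) = 1 →
            OriginCondition v (coveringPoly D b a))) := by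

  refine ⟨fun _ => ⟨fun h c hc => ?_, fun h c hc => ?_⟩,
    fun _ => ⟨fun h c hc => ?_, fun h c hc => ?_, fun v _ h => ?_⟩⟩
  · exact hc.isTwoPeriodic hg fun v hv => nonVanishing_of_lengthGcd_eq_one hv.1 (h v hv)
  · exact hc.isPeriodic hg fun v hv w hw h1 h2 => h v hv w hw
      (mt (nonVanishing_of_lengthGcd_eq_one hv.1) h1) (mt (nonVanishing_of_lengthGcd_eq_one hw.1) h2)
  · exact hc.isTwoPeriodic hg fun v hv => nonVanishing_of_originCondition hv.1 (h v hv)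
  · exact hc.isPeriodic hg fun v hv w hw h1 h2 => h v hv w hw
      (mt (nonVanishing_of_originCondition hv.1) h1) (mt (nonVanishing_of_originCondition hw.1) h2)
  · rw [OriginCondition, h, phi_one]
    exact isRelPrime_one_left
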